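/- Let $E$ be a finite set and let $M$ be a loopless oriented matroid of rank $d$ on $E$, with underlying matroid $\underline M$. For a flag of flats $\mathcal F:\emptyset=F_0\subsetneq F_1\subsetneq\dots\subsetneq F_t=E$ of $\underline M$ (not necessarily complete), let $\sigma_{\mathcal F}\subseteq\mathbb R^E$ be the cone generated by the indicator vectors $e_{F_1},\dots,e_{F_{t-1}}$ and $\pm e_E$, and let $M_{\mathcal F}=\bigoplus_{i=0}^{t-1}M|_{F_{i+1}}/F_i$ be the initial oriented matroid. The cones $\sigma_{\mathcal F}$ form the fan $\Sigma_{\underline M}$. A cosheaf on it is a contravariant functor from the poset of its cones, ordered by inclusion, to $\mathbb Z$-modules. For a loopless oriented matroid $N$ on $E$ with set of topes $\mathcal T(N)\subseteq\{+,-\}^E$, let $h_e:\mathcal T(N)\to\mathbb Z$ ($e\in E$) be the function with $h_e(T)=1$ if $T_e=+$ and $h_e(T)=0$ if $T_e=-$. Let $\mathcal P^p(N)$ be the set of functions $\mathcal T(N)\to\mathbb Z$ that can be written as polynomials of degree at most $p$ with integer coefficients in the $h_e$, let $\mathcal P^{-1}(N)=0$, and let $\mathcal P_p(N)\subseteq\mathbb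 Z[\mathcal T(N)]$ be the annihilator of $\mathcal P^{p-1}(N)$ under the evaluation pairing. Let $\mathcal A^\bullet(N)$ be the Cordovil algebra, the quotient of $\mathbb Z[x_e^*:e\in E]$ by the ideal generated by all $(x_e^*)^2$ and all $\sum_{k}C(i_k)\,x^*_{i_1}\cdots\widehat{x^*_{i_k}}\cdots x^*_{i_t}$, where $C$ runs over the signed circuits of $N$ and $\{i_1,\dots,i_t\}$ is the support of $C$. Let $\mathcal A_p(N)$ be the dual of its degree $p$ part, that is, the submodule of the degree $p$ part of $\mathbb Z[x_e:e\in E]/\langle x_e^2\rangle$ that annihilates this ideal under the pairing with $\langle (x^*)^S,x^T\rangle=\delta_{S,T}$ for $S,T\subseteq E$ (and with all monomials in the $x_e^*$ that are not square-free pairing to $0$). Then, whenever $\sigma_{\mathcal F'}\subseteq\sigma_{\mathcal F}$, we have inclusions $\mathbb Z[\mathcal T(M_{\mathcal F})]\subseteq\mathbb Z[\mathcal T(M_{\mathcal F'})]$ and, for all $p\ge 0$, $\mathcal P_p(M_{\mathcal F})\subseteq\mathcal P_p(M_{\mathcal F'})$ and $\mathcal A_p(M_{\mathcal F})\subseteq\mathcal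 A_p(M_{\mathcal F'})$. With these inclusions as structure maps, the assignments $\sigma_{\mathcal F}\mapsto\mathbb Z[\mathcal T(M_{\mathcal F})]$, $\sigma_{\mathcal F}\mapsto\mathcal P_p(M_{\mathcal F})$ and $\sigma_{\mathcal F}\mapsto\mathcal A_p(M_{\mathcal F})$ are cosheaves $\mathcal S$ (the $\mathbb Z$-sign cosheaf), $\mathfrak P_p$ and $\mathfrak A_p$ (the $p$-th Cordovil cosheaf) on $\Sigma_{\underline M}$. The inclusions are injective maps of cosheaves $$0=\mathfrak P_{d+1}\subset\mathfrak P_d\subset\dots\subset\mathfrak P_{p+1}\subset\mathfrak P_p\subset\dots\subset\mathfrak P_1\subset\mathfrak P_0=\mathcal S,$$ and for every $p\ge 0$ there is a short exact sequence of cosheaves $$0\to\mathfrak P_{p+1}\to\mathfrak P_p\to\mathfrak A_p\to 0,$$ whose first map is the inclusion. -/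

import Mathlib

open CategoryTheory

universe u

/-! ### Sign vectors -/

namespace SignVec

variable {E : Type*}

/-- Composition of sign vectors: `X ∘ Y` is `X` where `X` is nonzero and `Y` elsewhere. -/
def comp (X Y : E → SignType) : E → SignType := fun e => if X e = 0 then Y e else X e

/-- The separation set of two sign vectors. -/
def sep (X Y : E → SignType) : Set E := {e | X e ≠ 0 ∧ Y e = -X e}

/-- The order on sign vectors induced by `0 < +`, `0 < -` with `+`, `-` incomparable
(this is not the linear order `-1 < 0 < 1` of `SignType`). -/
def faceLE (X Y : E → SignType) : Prop := ∀ e, X e ≠ 0 → Y e = X e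

/-- Orthogonality of sign vectors. -/
def Orthogonal (X Y : E → SignType) : Prop :=
  (∀ e, X e * Y e = 0) ∨ ((∃ e, X e * Y e = 1) ∧ ∃ e, X e * Y e = -1)

end SignVec

/-! ### Oriented matroids, through the covector axioms -/

/-- An oriented matroid with ground set `E`, given by its set of covectors. -/
structure OrientedMatroid (E : Type u) where
  /-- The set of covectors. -/
  covectors : Set (E → SignType)
  zero_mem : 0 ∈ covectors
  neg_mem : ∀ X ∈ covectors, -X ∈ covectors
  comp_mem : ∀ X ∈ covectors, ∀ Y ∈ covectors, SignVec.comp X Y ∈ covectors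
  elim : ∀ X ∈ covectors, ∀ Y ∈ covectors, ∀ e ∈ SignVec.sep X Y,
    ∃ Z ∈ covectors, Z e = 0 ∧ ∀ f, f ∉ SignVec.sep X Y → Z f = SignVec.comp X Y f

namespace OrientedMatroid

variable {E : Type u}

/-- `M` has no loops: every element is nonzero in some covector. -/
def Loopless (M : OrientedMatroid E) : Prop := ∀ e, ∃ X ∈ M.covectors, X e ≠ 0

/-- The topes: the maximal covectors. -/
def topes (M : OrientedMatroid E) : Set (E → SignType) :=
  {T | T ∈ M.covectors ∧ ∀ Y ∈ M.covectors, SignVec.faceLE T Y → Y = T}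

/-- The flats of the underlying matroid: the zero sets of the covectors. -/
def IsFlat (M : OrientedMatroid E) (F : Set E) : Prop :=
  ∃ X ∈ M.covectors, F = {e | X e = 0}

/-- Signed circuits: the nonzero sign vectors of minimal support among those that are orthogonal
to all covectors. Their supports are the circuits of the underlying matroid. -/
def IsSignedCircuit (M : OrientedMatroid E) (C : E → SignType) : Prop :=
  (C ≠ 0 ∧ ∀ X ∈ M.covectors, SignVec.Orthogonal C X) ∧
  ∀ D : E → SignType, D ≠ 0 → (∀ X ∈ M.covectors, SignVec.Orthogonal D X) →
    Function.support D ⊆ Function.support C → Function.support D = Function.support C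

/-- Independent sets of the underlying matroid: those that contain no circuit. -/
def Indep (M : OrientedMatroid E) (I : Set E) : Prop :=
  ∀ C, M.IsSignedCircuit C → ¬ Function.support C ⊆ I

open Classical in
/-- The rank of the underlying matroid: the largest size of an independent set. -/
noncomputable def rank [Fintype E] (M : OrientedMatroid E) : ℕ :=
  (Finset.univ.filter fun I : Finset E => M.Indep (I : Set E)).sup Finset.card

/-! ### Minors, flags of flats and initial oriented matroids -/

/-- The minor `M|_B / A` for `A ⊆ B`, with ground set `B \ A`: its covectors are the restrictions
to `B \ A` of the covectors of `M` that vanish on `A`. -/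
def minor (M : OrientedMatroid E) (A B : Set E) : OrientedMatroid ↥(B \ A) where
  covectors := {X | ∃ Y ∈ M.covectors, (∀ e ∈ A, Y e = 0) ∧ ∀ e : ↥(B \ A), X e = Y e}
  zero_mem := ⟨0, M.zero_mem, fun _ _ => rfl, fun _ => rfl⟩
  neg_mem := by
    rintro X ⟨Y, hY, hA, hB⟩
    refine ⟨-Y, M.neg_mem Y hY, fun e he => ?_, fun e => ?_⟩
    · simp [hA e he]
    · simp [hB e]
  comp_mem := by
    rintro X ⟨Y, hY, hA, hB⟩ X' ⟨Y', hY', hA', hB'⟩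
    refine ⟨SignVec.comp Y Y', M.comp_mem Y hY Y' hY', fun e he => ?_, fun e => ?_⟩
    · simp [SignVec.comp, hA e he, hA' e he]
    · simp [SignVec.comp, hB e, hB' e]
  elim := by
    rintro X ⟨Y, hY, hA, hB⟩ X' ⟨Y', hY', hA', hB'⟩ e he
    have hs : ∀ f : ↥(B \ A), (f : E) ∈ SignVec.sep Y Y' ↔ f ∈ SignVec.sep X X' := fun f => by
      simp [SignVec.sep, hB f, hB' f]
    obtain ⟨Z, hZ, hZe, hZf⟩ := M.elim Y hY Y' hY' e ((hs e).2 he)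
    refine ⟨fun f => Z f, ⟨Z, hZ, fun f hf => ?_, fun f => rfl⟩, hZe, fun f hf => ?_⟩
    · rw [hZf f (by simp [SignVec.sep, hA f hf])]
      simp [SignVec.comp, hA f hf, hA' f hf]
    · have := hZf f (fun h => hf ((hs f).1 h))
      simpa [SignVec.comp, hB f, hB' f] using this

/-- A flag of flats `∅ = F_0 < F_1 < ⋯ < F_t = E`, not necessarily complete. -/
structure FlatFlag (M : OrientedMatroid E) where
  /-- The number of steps `t`. -/
  length : ℕ
  /-- The flats of the flag. -/
  flat : Fin (length + 1) → Set E
  isFlat : ∀ i, M.IsFlat (flat i)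
  strictMono : StrictMono flat
  flat_zero : flat 0 = ∅
  flat_last : flat (Fin.last length) = Set.univ

/-- The initial oriented matroid `M_F`, the direct sum of the minors `M|_{F_{i+1}} / F_i`:
its covectors are the sign vectors whose restriction to each `F_{i+1} \ F_i` is a covector
of `M|_{F_{i+1}} / F_i`. -/
def initial (M : OrientedMatroid E) (F : M.FlatFlag) : OrientedMatroid E where
  covectors := {X | ∀ i : Fin F.length,
    (fun e : ↥(F.flat i.succ \ F.flat i.castSucc) => X e) ∈
      (M.minor (F.flat i.castSucc) (F.flat i.succ)).covectors}
  zero_mem := fun i => (M.minor (F.flat i.castSucc) (F.flat i.succ)).zero_mem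
  neg_mem := fun X hX i => (M.minor (F.flat i.castSucc) (F.flat i.succ)).neg_mem _ (hX i)
  comp_mem := fun X hX Y hY i =>
    (M.minor (F.flat i.castSucc) (F.flat i.succ)).comp_mem _ (hX i) _ (hY i)
  elim := by
    classical
    intro X hX Y hY e he
    -- the block `i₀` that contains `e`
    have hex : ∃ k : ℕ, ∃ h : k < F.length + 1, e ∈ F.flat ⟨k, h⟩ :=
      ⟨F.length, Nat.lt_succ_self _, by
        have := F.flat_last
        rw [Fin.last] at this
        rw [this]; trivial⟩
    obtain ⟨hk, hek⟩ := Nat.find_spec hex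
    have hmin := fun m => Nat.find_min hex (m := m)
    generalize Nat.find hex = k at hk hek hmin
    cases k with
    | zero =>
      have h0 : e ∈ F.flat 0 := hek
      rw [F.flat_zero] at h0
      exact h0.elim
    | succ k =>
      have hkl : k < F.length := by omega
      have hne : e ∉ F.flat (Fin.castSucc ⟨k, hkl⟩) := fun h =>
        hmin k (Nat.lt_succ_self k) ⟨by omega, h⟩
      have hin : e ∈ F.flat (Fin.succ ⟨k, hkl⟩) := hek
      set i₀ : Fin F.length := ⟨k, hkl⟩ with hi₀
      obtain ⟨Z₀, hZ₀, hZ₀e, hZ₀f⟩ :=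
        (M.minor (F.flat i₀.castSucc) (F.flat i₀.succ)).elim _ (hX i₀) _ (hY i₀) ⟨e, hin, hne⟩ he
      refine ⟨fun f => if h : f ∈ F.flat i₀.succ \ F.flat i₀.castSucc then Z₀ ⟨f, h⟩ else
        SignVec.comp X Y f, fun i => ?_, ?_, fun f hf => ?_⟩
      · by_cases hi : i = i₀
        · subst hi
          convert hZ₀ using 1
          funext f
          exact dif_pos f.2
        · convert (M.minor (F.flat i.castSucc) (F.flat i.succ)).comp_mem _ (hX i) _ (hY i) using 1
          funext f
          have hf : (f : E) ∉ F.flat i₀.succ \ F.flat i₀.castSucc := by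
            rintro ⟨h1, h2⟩
            rcases lt_or_gt_of_ne hi with hlt | hlt
            · exact h2 (F.strictMono.monotone (by
                rw [Fin.le_def]; simpa using Nat.succ_le_of_lt (Fin.lt_def.1 hlt)) f.2.1)
            · exact f.2.2 (F.strictMono.monotone (by
                rw [Fin.le_def]; simpa using Nat.succ_le_of_lt (Fin.lt_def.1 hlt)) h1)
          exact dif_neg hf
      · simpa [hin, hne] using hZ₀e
      · by_cases h : f ∈ F.flat i₀.succ \ F.flat i₀.castSucc
        · exact (dif_pos h).trans (hZ₀f ⟨f, h⟩ hf)
        · exact dif_neg h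

/-! ### The matroid fan -/

/-- The cone `σ_F` spanned by the indicator vectors `e_{F_i}` of the flats of the flag
(among them `e_{F_t} = e_E`) and by `-e_E`. -/
def FlatFlag.cone {M : OrientedMatroid E} (F : M.FlatFlag) : PointedCone ℝ (E → ℝ) :=
  PointedCone.hull ℝ
    (Set.range (fun i => (F.flat i).indicator (1 : E → ℝ)) ∪ {-(Set.univ.indicator (1 : E → ℝ))})

/-- The cones of the matroid fan, indexed by the flags of flats and ordered by inclusion of cones.
As a category, this is the fan: there is one morphism `σ_{F'} ⟶ σ_F` if `σ_{F'} ⊆ σ_F`,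
and none otherwise. -/
instance (M : OrientedMatroid E) : Preorder M.FlatFlag := Preorder.lift FlatFlag.cone

/-- An inclusion of cones is the same as an inclusion of flags. -/
theorem FlatFlag.le_iff {M : OrientedMatroid E} {F' F : M.FlatFlag} :
    F' ≤ F ↔ Set.range F'.flat ⊆ Set.range F.flat := by
  classical
  constructor
  · intro h
    have key : ∀ v ∈ F.cone, ∀ e f, (∀ i, e ∈ F.flat i → f ∈ F.flat i) → v e ≤ v f := by
      intro v hv e f hef
      induction hv using Submodule.span_induction with
      | mem x hx =>
        rcases hx with ⟨i, rfl⟩ | rfl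
        · by_cases he : e ∈ F.flat i
          · simp [he, hef i he]
          · simp only [Set.indicator_of_notMem he]
            exact Set.indicator_nonneg (fun _ _ => zero_le_one) _
        · simp
      | zero => simp
      | add x y _ _ hx hy => exact add_le_add hx hy
      | smul a x _ hx => exact mul_le_mul_of_nonneg_left hx a.2
    rintro _ ⟨j, rfl⟩
    have hj : (F'.flat j).indicator (1 : E → ℝ) ∈ F.cone :=
      h (Submodule.subset_span (Or.inl ⟨j, rfl⟩))
    have key' := key _ hj
    have hex : ∃ k : ℕ, ∃ h : k < F.length + 1, F'.flat j ⊆ F.flat ⟨k, h⟩ :=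
      ⟨F.length, Nat.lt_succ_self _, by
        have := F.flat_last
        rw [Fin.last] at this
        rw [this]; exact Set.subset_univ _⟩
    obtain ⟨hk, hek⟩ := Nat.find_spec hex
    have hmin := fun m => Nat.find_min hex (m := m)
    generalize Nat.find hex = k at hk hek hmin
    refine ⟨⟨k, hk⟩, (hek.antisymm ?_).symm⟩
    cases k with
    | zero =>
      have h0 : F.flat ⟨0, hk⟩ = ∅ := F.flat_zero
      rw [h0]; exact Set.empty_subset _
    | succ k =>
      have hnot : ¬ F'.flat j ⊆ F.flat ⟨k, by omega⟩ := fun h =>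
        hmin k (Nat.lt_succ_self k) ⟨by omega, h⟩
      obtain ⟨e, he, hne⟩ := Set.not_subset.1 hnot
      intro f hf
      have h1 := key' e f (fun i hi => by
        refine F.strictMono.monotone ?_ hf
        by_contra hlt
        refine hne (F.strictMono.monotone ?_ hi)
        rw [Fin.le_def] at hlt ⊢
        simp only at hlt ⊢
        omega)
      by_contra hfn
      rw [Set.indicator_of_mem he, Set.indicator_of_notMem hfn] at h1
      norm_num at h1
  · intro h
    refine Submodule.span_mono (Set.union_subset_union_left _ ?_)
    rintro _ ⟨i, rfl⟩
    obtain ⟨j, hj⟩ := h ⟨i, rfl⟩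
    exact ⟨j, by simp only [hj]⟩

/-! ### The tope space and the dual Varchenko–Gelfand filtration -/

/-- The Heaviside function `h_e`, in the Varchenko–Gelfand ring of integer valued functions on the
topes (equivalently, of linear functions on the tope space). -/
def heaviside (M : OrientedMatroid E) (e : E) : M.topes → ℤ := fun T => if T.1 e = 1 then 1 else 0

/-- The degree filtration `P^p` of the Varchenko–Gelfand ring: the functions that are represented
by a polynomial of degree at most `p` in the Heaviside functions. -/
noncomputable def degreeFiltration (M : OrientedMatroid E) (p : ℕ) : Submodule ℤ (M.topes → ℤ) :=
  (MvPolynomial.restrictTotalDegree E ℤ p).map (MvPolynomial.aeval M.heaviside).toLinearMap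

/-- The dual degree filtration `P_p` of the tope space `ℤ[T(M)]`: the annihilator of `P^{p-1}`,
where `P^{-1} = 0`. -/
noncomputable def dualFiltration (M : OrientedMatroid E) : ℕ → Submodule ℤ (M.topes →₀ ℤ)
  | 0 => ⊤
  | p + 1 => ⨅ f ∈ M.degreeFiltration p, LinearMap.ker (Finsupp.linearCombination ℤ f)

/-- The inclusion of the tope space `ℤ[T(M)]` into the free module on all sign vectors. -/
noncomputable def topeIncl (M : OrientedMatroid E) :
    (M.topes →₀ ℤ) →ₗ[ℤ] ((E → SignType) →₀ ℤ) :=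
  Finsupp.lmapDomain ℤ ℤ Subtype.val

/-- The tope spaces `ℤ[T(M_F)]`, as submodules of the free module on all sign vectors. -/
noncomputable def signStalk (M : OrientedMatroid E) (F : M.FlatFlag) :
    Submodule ℤ ((E → SignType) →₀ ℤ) :=
  LinearMap.range (M.initial F).topeIncl

/-- The modules `P_p(M_F) ⊆ ℤ[T(M_F)]`, as submodules of the free module on all sign vectors. -/
noncomputable def vgStalk (M : OrientedMatroid E) (p : ℕ) (F : M.FlatFlag) :
    Submodule ℤ ((E → SignType) →₀ ℤ) :=
  ((M.initial F).dualFiltration p).map (M.initial F).topeIncl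

end OrientedMatroid

/-! ### The Cordovil algebra and its dual -/

/-- The algebra `ℤ[x_i : i ∈ E] / ⟨x_i²⟩`. -/
abbrev SFSym (E : Type u) : Type u :=
  MvPolynomial E ℤ ⧸ Ideal.span (Set.range fun i : E => (MvPolynomial.X i : MvPolynomial E ℤ) ^ 2)

namespace SFSym

variable {E : Type u}

/-- The square-free monomial `x^S`. -/
noncomputable def mono (S : Finset E) : SFSym E :=
  Ideal.Quotient.mk _ (∏ i ∈ S, MvPolynomial.X i)

/-- The square-free coefficients of an element of `⟨x_i²⟩` vanish. -/
theorem coeff_eq_zero_of_mem {q : MvPolynomial E ℤ}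
    (hq : q ∈ Ideal.span (Set.range fun i : E => (MvPolynomial.X i : MvPolynomial E ℤ) ^ 2)) :
    ∀ m : E →₀ ℕ, (∀ i, m i ≤ 1) → MvPolynomial.coeff m q = 0 := by
  classical
  induction hq using Submodule.span_induction with
  | mem x hx =>
    obtain ⟨i, rfl⟩ := hx
    intro m hm
    rw [MvPolynomial.coeff_X_pow, if_neg]
    rintro rfl
    simpa using hm i
  | zero => simp
  | add x y _ _ hx hy => intro m hm; rw [MvPolynomial.coeff_add, hx m hm, hy m hm, add_zero]
  | smul a x _ hx =>
    intro m hm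
    rw [smul_eq_mul, MvPolynomial.coeff_mul]
    refine Finset.sum_eq_zero fun y hy => ?_
    rw [hx y.2 fun i => ?_, mul_zero]
    have := DFunLike.congr_fun (Finset.HasAntidiagonal.mem_antidiagonal.1 hy) i
    rw [Finsupp.add_apply] at this
    have := hm i
    omega

/-- The coefficient of the square-free monomial `x^S`. -/
noncomputable def coeff (S : Finset E) : SFSym E →ₗ[ℤ] ℤ :=
  ((Ideal.span (Set.range fun i : E =>
      (MvPolynomial.X i : MvPolynomial E ℤ) ^ 2)).restrictScalars ℤ).liftQ
    (MvPolynomial.lcoeff ℤ (Finsupp.indicator S fun _ _ => 1)) (by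
      classical
      intro q hq
      refine coeff_eq_zero_of_mem hq _ fun i => ?_
      rw [Finsupp.indicator_apply]
      split_ifs <;> simp)

/-- The pairing of `SFSym E` with itself with `⟨x^S, x^T⟩ = δ_{S,T}`, as a functional in the second
variable. -/
noncomputable def pairing [Fintype E] (a : SFSym E) : SFSym E →ₗ[ℤ] ℤ :=
  ∑ S : Finset E, coeff S a • coeff S

/-- The square-free monomials are dual to themselves under the coefficient functionals. -/
theorem coeff_mono [DecidableEq E] (S T : Finset E) :
    coeff S (mono T) = if S = T then 1 else 0 := by
  have h : (∏ i ∈ T, MvPolynomial.X i : MvPolynomial E ℤ)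
      = MvPolynomial.monomial (Finsupp.indicator T fun _ _ => 1) 1 := by
    rw [MvPolynomial.monomial_eq, Finsupp.prod]
    simp only [MvPolynomial.C_1, one_mul]
    have hs : (Finsupp.indicator T fun _ _ => 1 : E →₀ ℕ).support = T := by
      ext i; simp [Finsupp.indicator_apply]
    rw [hs]
    refine Finset.prod_congr rfl fun i hi => ?_
    simp [Finsupp.indicator_apply, hi]
  change MvPolynomial.coeff _ (∏ i ∈ T, MvPolynomial.X i : MvPolynomial E ℤ) = _
  rw [h, MvPolynomial.coeff_monomial]
  refine if_congr ⟨fun e => ?_, fun e => by rw [e]⟩ rfl rfl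
  ext i
  have := DFunLike.congr_fun e i
  simp only [Finsupp.indicator_apply] at this
  by_cases hS : i ∈ S <;> by_cases hT : i ∈ T <;> simp_all

end SFSym

namespace OrientedMatroid

variable {E : Type u}

open Classical in
/-- The polynomial `∑_k C(i_k) x_{i_1} ⋯ x̂_{i_k} ⋯ x_{i_t}` of a sign vector `C` with support
`{i_1, …, i_t}`. -/
noncomputable def circuitPoly [Fintype E] (C : E → SignType) : MvPolynomial E ℤ :=
  ∑ k ∈ Finset.univ.filter (fun i => C i ≠ 0),
    MvPolynomial.C (C k : ℤ) * ∏ i ∈ (Finset.univ.filter fun i => C i ≠ 0).erase k, MvPolynomial.X i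

/-- The defining ideal of the Cordovil algebra `A^•(M) = ℤ[x_i : i ∈ E] / I`. -/
noncomputable def cordovilIdeal [Fintype E] (M : OrientedMatroid E) : Ideal (MvPolynomial E ℤ) :=
  Ideal.span ((Set.range fun i : E => (MvPolynomial.X i : MvPolynomial E ℤ) ^ 2) ∪
    {q | ∃ C, M.IsSignedCircuit C ∧ q = circuitPoly C})

/-- The dual `A_p(M)` of the degree `p` part of the Cordovil algebra, as a submodule of `SFSym E`:
the elements of degree `p` that pair to zero with the defining ideal. -/
noncomputable def cordovilDual [Fintype E] (M : OrientedMatroid E) (p : ℕ) :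
    Submodule ℤ (SFSym E) :=
  Submodule.span ℤ {a | ∃ S : Finset E, S.card = p ∧ a = SFSym.mono S} ⊓
    ⨅ q ∈ M.cordovilIdeal, LinearMap.ker (SFSym.pairing (Ideal.Quotient.mk _ q))

/-- The modules `A_p(M_F)`, as submodules of `SFSym E`. -/
noncomputable def cordovilStalk [Fintype E] (M : OrientedMatroid E) (p : ℕ) (F : M.FlatFlag) :
    Submodule ℤ (SFSym E) :=
  (M.initial F).cordovilDual p

/-! ### Cosheaves on the matroid fan -/

/-- Cosheaves of abelian groups on the matroid fan. -/
abbrev Cosheaf (M : OrientedMatroid E) := M.FlatFlagᵒᵖ ⥤ ModuleCat.{u} ℤ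

/-- The cosheaf of a family of submodules `N F` of a fixed module that reverses inclusions of cones;
its maps are the inclusions `N F ⊆ N F'` for `σ_{F'} ⊆ σ_F`. -/
def subCosheaf {M : OrientedMatroid E} {V : Type u} [AddCommGroup V] {N : M.FlatFlag → Submodule ℤ V}
    (hN : Antitone N) : M.Cosheaf where
  obj F := ModuleCat.of ℤ (N F.unop)
  map f := ModuleCat.ofHom (Submodule.inclusion (hN f.unop.le))

/-- The map of cosheaves given by inclusions of submodules. -/
def subCosheafIncl {M : OrientedMatroid E} {V : Type u} [AddCommGroup V]
    {N N' : M.FlatFlag → Submodule ℤ V} (hN : Antitone N) (hN' : Antitone N')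
    (h : ∀ F, N F ≤ N' F) : subCosheaf hN ⟶ subCosheaf hN' where
  app F := ModuleCat.ofHom (Submodule.inclusion (h F.unop))

end OrientedMatroid

/-!
The dual Varchenko–Gelfand filtration and the dual Cordovil modules of an oriented matroid `N` are
compared by one formula: a chain `γ` of topes is sent to `∑ ⟨h_S, γ⟩ x^S`, where `h_S` is the product
of the Heaviside functions of `S` and `S` runs over the sets of size `p` (`leadingPart`). The formula
makes sense for chains of arbitrary sign vectors, so it is compatible with all inclusions of stalks,
and it remains to see that for each loopless `N` it induces an exact sequence
`0 → P_{p+1}(N) → P_p(N) → A_p(N) → 0`.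

* The kernel is `P_{p+1}(N)` by definition, as `h_e² = h_e` makes the `h_S` with `|S| ≤ p` span the
  functions of degree at most `p`.
* The image lies in `A_p(N)`, because the polynomial of a signed circuit is the leading part of a
  relation between Heaviside functions (`sum_topeMono_circuit_mem`).
* Surjectivity rests on no broken circuit sets. Both algebras satisfy the same straightening rule
  (`mem_of_isNBC_of_circuit_relations`), so an element of `A_p(N)` is determined by its coefficients
  on no broken circuit sets, and the corresponding `h_S` span the Varchenko–Gelfand ring, compatibly
  with degrees. These `h_S` are linearly independent by deletion and contraction
  (`coeff_eq_zero_of_isNBC`), hence a basis, and a chain with prescribed pairings exists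
  (`exists_leadingPart_eq`).

Only the covector axioms enter: independence is expressed by shattering (every sign pattern on the
set is attained by a covector), and a set that is not shattered contains a signed circuit
(`exists_isSignedCircuit_of_not_shatters`), which avoids the duality theory of oriented matroids.

For `σ_{F'} ⊆ σ_F`, covectors of consecutive minors compose, so that topes of `M_F` are topes of
`M_{F'}`; this gives the inclusions for tope spaces and for `P_p`, and those for `A_p` follow by
surjectivity of the leading part maps. Finally no broken circuit sets of `M_F` are independent in `M`,
so functions on the topes of `M_F` have degree at most the rank of `M`, and the filtration stops.
-/

/-! ### Shattered sets and no broken circuit sets -/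

namespace OrientedMatroid

variable {E : Type u}

/-- The covectors of `M` that vanish on `A` shatter `K` if they restrict to all nowhere zero sign
vectors on `K`. For `A = ∅` these are the independent sets of the underlying matroid, and for
general `A` those of the contraction `M / A`. -/
def Shatters (M : OrientedMatroid E) (A K : Set E) : Prop :=
  ∀ s : E → SignType, (∀ e ∈ K, s e ≠ 0) →
    ∃ X ∈ M.covectors, (∀ e ∈ A, X e = 0) ∧ ∀ e ∈ K, X e = s e

theorem Shatters.mono {M : OrientedMatroid E} {A K K' : Set E} (h : M.Shatters A K)
    (hK : K' ⊆ K) : M.Shatters A K' := by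
  classical
  intro s hs
  obtain ⟨X, hX, hA, hXK⟩ := h (fun e => if e ∈ K' then s e else 1) (fun e _ => by
    by_cases he : e ∈ K'
    · simpa [he] using hs e he
    · simp [he])
  exact ⟨X, hX, hA, fun e he => by simpa [he] using hXK e (hK he)⟩

/-- Contracting an element of a shattered set: the two covectors with a given pattern on the rest
and opposite signs at `a` are eliminated at `a`. -/
theorem Shatters.contract {M : OrientedMatroid E} {A K : Set E} {a : E} (ha : a ∉ K)
    (h : M.Shatters A (insert a K)) : M.Shatters (insert a A) K := by
  classical
  intro s hs
  have key : ∀ t : SignType, t ≠ 0 → ∃ X ∈ M.covectors, (∀ e ∈ A, X e = 0) ∧ X a = t ∧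
      ∀ e ∈ K, X e = s e := by
    intro t ht
    obtain ⟨X, hX, hA, hXK⟩ := h (fun e => if e = a then t else s e) (fun e he => by
      by_cases hea : e = a
      · simpa [hea] using ht
      · simpa [hea] using hs e (he.resolve_left hea))
    refine ⟨X, hX, hA, by simpa using hXK a (Set.mem_insert _ _), fun e he => ?_⟩
    have hea : e ≠ a := fun h => ha (h ▸ he)
    simpa [hea] using hXK e (Set.mem_insert_of_mem _ he)
  obtain ⟨X, hX, hXA, hXa, hXK⟩ := key 1 (by decide)
  obtain ⟨Y, hY, hYA, hYa, hYK⟩ := key (-1) (by decide)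
  obtain ⟨Z, hZ, hZa, hZf⟩ := M.elim X hX Y hY a ⟨by rw [hXa]; decide, by rw [hXa, hYa]⟩
  have hsep : ∀ f, X f = Y f → Z f = X f := fun f hf => by
    rw [hZf f]
    · by_cases h0 : X f = 0 <;> simp [SignVec.comp, h0, ← hf]
    · rintro ⟨h1, h2⟩
      rw [← hf] at h2
      revert h1 h2
      cases X f <;> decide
  refine ⟨Z, hZ, ?_, fun e he => ?_⟩
  · rintro e (rfl | he)
    · exact hZa
    · rw [hsep e (by rw [hXA e he, hYA e he]), hXA e he]
  · rw [hsep e (by rw [hXK e he, hYK e he]), hXK e he]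

/-- `S` is a no broken circuit set of the minor of `M` with contracted set `A` and ground set `B`,
for the order on the ground set given by `r`. A set `S` contains a broken circuit (a circuit
without its least element `m`) precisely if some `m` is dependent on the elements of `S` that are
larger than `m`, which is how the notion is encoded. -/
def IsNBC (M : OrientedMatroid E) (r : E → ℕ) (A B S : Finset E) : Prop :=
  S ⊆ B ∧ ∀ m ∈ B, M.Shatters A (insert m {e | e ∈ S ∧ r m < r e})

theorem IsNBC.shatters {M : OrientedMatroid E} {r : E → ℕ} (hr : Function.Injective r)
    {A B S : Finset E} (h : M.IsNBC r A B S) (hB : B.Nonempty) :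
    M.Shatters A S := by
  rcases S.eq_empty_or_nonempty with rfl | hS
  · obtain ⟨m, hm⟩ := hB
    exact (h.2 m hm).mono (by simp)
  · obtain ⟨m, hm, hmin⟩ := S.exists_min_image r hS
    refine (h.2 m (h.1 hm)).mono fun e he => ?_
    by_cases hem : e = m
    · exact Or.inl hem
    · exact Or.inr ⟨he, lt_of_le_of_ne (hmin e he) fun h => hem (hr h).symm⟩

/-- The product of the Heaviside functions of the elements of `S`, as a function on all sign
vectors. -/
def heavisideMono (S : Finset E) (X : E → SignType) : ℤ := ∏ e ∈ S, if X e = 1 then 1 else 0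

theorem heavisideMono_congr {S : Finset E} {X Y : E → SignType} (h : ∀ e ∈ S, X e = Y e) :
    heavisideMono S X = heavisideMono S Y :=
  Finset.prod_congr rfl fun e he => by rw [h e he]

theorem heavisideMono_eq_ite (S : Finset E) (X : E → SignType) :
    heavisideMono S X = if ∀ e ∈ S, X e = 1 then 1 else 0 := by
  rw [heavisideMono, Finset.prod_ite_zero, Finset.prod_const_one]

theorem heavisideMono_mul [DecidableEq E] (S T : Finset E) (X : E → SignType) :
    heavisideMono S X * heavisideMono T X = heavisideMono (S ∪ T) X := by
  simp only [heavisideMono_eq_ite, Finset.mem_union, or_imp, forall_and, ite_and, mul_ite, mul_one,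
    mul_zero]
  split_ifs <;> rfl

/-- The Heaviside monomials of the no broken circuit sets are linearly independent on the topes of
each minor. The largest element `a` of the ground set is removed: a covector `Z` of the contraction
of `a` extends to two topes that differ at `a`, and the difference of the two relations is a
relation in the contraction between the monomials divisible by `h_a`; the monomials that remain
live on the deletion of `a`. -/
theorem coeff_eq_zero_of_isNBC [DecidableEq E] (M : OrientedMatroid E) {r : E → ℕ}
    (hr : Function.Injective r) (B : Finset E) :
    ∀ (A : Finset E) (c : Finset E → ℤ), (∀ S, c S ≠ 0 → M.IsNBC r A B S) →
      (∀ X ∈ M.covectors, (∀ e ∈ A, X e = 0) → (∀ e ∈ B, X e ≠ 0) →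
        ∑ S ∈ B.powerset, c S * heavisideMono S X = 0) → ∀ S, c S = 0 := by
  induction B using Finset.induction_on_max_value r with
  | empty =>
    intro A c hc h S
    by_contra hS
    obtain rfl := Finset.subset_empty.1 (hc S hS).1
    have := h 0 M.zero_mem (fun _ _ => rfl) (by simp)
    simp [heavisideMono] at this
    exact hS this
  | insert a B ha hmax ih =>
    intro A c hc h
    by_cases hex : ∃ S, c S ≠ 0
    swap
    · push Not at hex
      exact hex
    -- `a` is not a loop of the contraction of `A`
    obtain ⟨S₀, hS₀⟩ := hex
    obtain ⟨Y, hY, hYA, hYa⟩ := (hc S₀ hS₀).2 a (Finset.mem_insert_self _ _) (fun _ => 1)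
      (fun _ _ => by decide)
    replace hYa : Y a = 1 := hYa a (Set.mem_insert _ _)
    have hsum : ∀ X ∈ M.covectors, (∀ e ∈ A, X e = 0) → (∀ e ∈ insert a B, X e ≠ 0) →
        ∑ S ∈ B.powerset, c S * heavisideMono S X + (if X a = 1 then 1 else 0) *
          ∑ S ∈ B.powerset, c (insert a S) * heavisideMono S X = 0 := by
      intro X hX hXA hXB
      refine Eq.trans ?_ (h X hX hXA hXB)
      rw [Finset.sum_powerset_insert ha, Finset.mul_sum]
      congr 1
      refine Finset.sum_congr rfl fun S hS => ?_
      have haS : a ∉ S := fun h => ha (Finset.mem_powerset.1 hS h)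
      rw [heavisideMono, heavisideMono, Finset.prod_insert haS]
      ring
    have hcontr : ∀ S, a ∉ S → c (insert a S) = 0 := by
      have key := ih (insert a A) (fun S => if a ∈ S then 0 else c (insert a S)) ?_ ?_
      · intro S hS
        simpa [hS] using key S
      · intro S hS
        by_cases haS : a ∈ S
        · simp [haS] at hS
        · simp only [haS, if_false] at hS
          obtain ⟨h1, h2⟩ := hc _ hS
          refine ⟨fun e he => ?_, fun m hm => ?_⟩
          · exact (Finset.mem_insert.1 (h1 (Finset.mem_insert_of_mem he))).resolve_left
              fun h => haS (h ▸ he)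
          · have hma : m ≠ a := fun h => ha (h ▸ hm)
            rw [Finset.coe_insert]
            have hlt : r m < r a := lt_of_le_of_ne (hmax m hm) fun h => hma (hr h)
            refine Shatters.contract ?_ ((h2 m (Finset.mem_insert_of_mem hm)).mono ?_)
            · rintro (h | h)
              · exact hma h.symm
              · exact haS h.1
            · rintro e (rfl | rfl | he)
              · exact Or.inr ⟨Finset.mem_insert_self _ _, hlt⟩
              · exact Or.inl rfl
              · exact Or.inr ⟨Finset.mem_insert_of_mem he.1, he.2⟩
      · intro Z hZ hZA hZB
        have hZa : Z a = 0 := hZA a (Finset.mem_insert_self _ _)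
        have hext : ∀ W ∈ M.covectors, (∀ e ∈ A, W e = 0) → W a ≠ 0 →
            ∑ S ∈ B.powerset, c S * heavisideMono S Z + (if W a = 1 then 1 else 0) *
              ∑ S ∈ B.powerset, c (insert a S) * heavisideMono S Z = 0 := by
          intro W hW hWA hWa
          have hB : ∀ e ∈ B, SignVec.comp Z W e = Z e := fun e he => by
            simp [SignVec.comp, hZB e he]
          have := hsum _ (M.comp_mem Z hZ W hW)
            (fun e he => by simp [SignVec.comp, hZA e (Finset.mem_insert_of_mem he), hWA e he])
            (fun e he => by
              rcases Finset.mem_insert.1 he with rfl | he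
              · simpa [SignVec.comp, hZa] using hWa
              · rw [hB e he]
                exact hZB e he)
          have hca : SignVec.comp Z W a = W a := by simp [SignVec.comp, hZa]
          rw [hca] at this
          refine Eq.trans ?_ this
          congr 1
          · refine Finset.sum_congr rfl fun S hS => ?_
            rw [heavisideMono_congr fun e he => (hB e (Finset.mem_powerset.1 hS he)).symm]
          · congr 1
            refine Finset.sum_congr rfl fun S hS => ?_
            rw [heavisideMono_congr fun e he => (hB e (Finset.mem_powerset.1 hS he)).symm]
        have h1 := hext Y hY hYA (by rw [hYa]; decide)
        have h2 := hext (-Y) (M.neg_mem Y hY) (fun e he => by simp [hYA e he])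
          (by rw [Pi.neg_apply, hYa]; decide)
        rw [hYa, if_pos rfl, one_mul] at h1
        rw [Pi.neg_apply, hYa, if_neg (by decide), zero_mul, add_zero] at h2
        rw [h2, zero_add] at h1
        rw [← h1]
        refine Finset.sum_congr rfl fun S hS => ?_
        rw [if_neg fun h => ha (Finset.mem_powerset.1 hS h)]
    have hcontr' : ∀ S, a ∈ S → c S = 0 := fun S hS => by
      rw [← Finset.insert_erase hS]
      exact hcontr _ (Finset.notMem_erase _ _)
    refine ih A c (fun S hS => ?_) fun X hX hXA hXB => ?_
    · obtain ⟨h1, h2⟩ := hc S hS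
      refine ⟨fun e he => (Finset.mem_insert.1 (h1 he)).resolve_left ?_,
        fun m hm => h2 m (Finset.mem_insert_of_mem hm)⟩
      rintro rfl
      exact hS (hcontr' S he)
    · have hB : ∀ e ∈ B, SignVec.comp X Y e = X e := fun e he => by
        simp [SignVec.comp, hXB e he]
      have := hsum _ (M.comp_mem X hX Y hY)
        (fun e he => by simp [SignVec.comp, hXA e he, hYA e he])
        (fun e he => by
          rcases Finset.mem_insert.1 he with rfl | he
          · by_cases h0 : X e = 0
            · simp [SignVec.comp, h0, hYa]
            · simp [SignVec.comp, h0]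
          · rw [hB e he]
            exact hXB e he)
      rw [Finset.sum_eq_zero (s := B.powerset)
        (f := fun S => c (insert a S) * heavisideMono S (SignVec.comp X Y)) (fun S hS => by
          rw [hcontr' _ (Finset.mem_insert_self _ _), zero_mul]), mul_zero, add_zero] at this
      rw [← this]
      refine Finset.sum_congr rfl fun S hS => ?_
      rw [heavisideMono_congr fun e he => (hB e (Finset.mem_powerset.1 hS he)).symm]

end OrientedMatroid

/-! ### Signed circuits and straightening -/

namespace OrientedMatroid

variable {E : Type u}

theorem exists_isSignedCircuit_support_subset [Finite E] {M : OrientedMatroid E} {D : E → SignType}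
    (hD : D ≠ 0) (hM : ∀ X ∈ M.covectors, SignVec.Orthogonal D X) :
    ∃ C, M.IsSignedCircuit C ∧ Function.support C ⊆ Function.support D := by
  induction h : (Function.support D).ncard using Nat.strong_induction_on generalizing D with
  | _ n ih =>
    by_cases hmin : M.IsSignedCircuit D
    · exact ⟨D, hmin, subset_rfl⟩
    · rw [IsSignedCircuit, not_and] at hmin
      have := hmin ⟨hD, hM⟩
      push Not at this
      obtain ⟨D', hD', hM', hsub, hne⟩ := this
      obtain ⟨C, hC, hCD⟩ := ih _ (h ▸ Set.ncard_lt_ncard (hsub.ssubset_of_ne hne)) hD' hM' rfl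
      exact ⟨C, hC, hCD.trans hsub⟩

/-- A set that is not shattered contains a circuit: a sign pattern missed by the covectors on a
minimal set that is not shattered is orthogonal to all covectors. -/
theorem exists_isSignedCircuit_of_not_shatters [Finite E] {M : OrientedMatroid E} {K : Set E}
    (hK : ¬ M.Shatters ∅ K) : ∃ C, M.IsSignedCircuit C ∧ Function.support C ⊆ K := by
  classical
  obtain ⟨K', hK'K, hK'⟩ := exists_minimal_le_of_wellFoundedLT (fun K => ¬ M.Shatters ∅ K) K hK
  have hns := hK'.prop
  unfold Shatters at hns
  push Not at hns
  obtain ⟨s, hs, hmiss⟩ := hns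
  set D : E → SignType := fun e => if e ∈ K' then s e else 0 with hDdef
  have hDK : ∀ e ∈ K', D e = s e := fun e he => if_pos he
  have hDK' : ∀ e ∉ K', D e = 0 := fun e he => if_neg he
  have hsupp : Function.support D ⊆ K' := fun e he => by
    by_contra h
    exact he (hDK' e h)
  -- a covector that agrees with `D` wherever both are nonzero must vanish on `K'`
  have key : ∀ X ∈ M.covectors, (∀ e ∈ K', X e ≠ 0 → X e = s e) → ∀ e ∈ K', X e = 0 := by
    intro X hX hXs
    by_contra! hne
    obtain ⟨e₀, he₀, hXe₀⟩ := hne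
    have hlt : {e ∈ K' | X e = 0} < K' :=
      ⟨fun e he => he.1, fun h => hXe₀ (h he₀).2⟩
    have hsh : M.Shatters ∅ {e ∈ K' | X e = 0} := by
      by_contra h
      exact hlt.not_ge (hK'.le_of_le h hlt.le)
    obtain ⟨Y, hY, -, hYs⟩ := hsh s fun e he => hs e he.1
    obtain ⟨e, he, hne⟩ := hmiss _ (M.comp_mem X hX Y hY) (by simp)
    refine hne ?_
    by_cases h0 : X e = 0
    · simpa [SignVec.comp, h0] using hYs e ⟨he, h0⟩
    · simpa [SignVec.comp, h0] using hXs e he h0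
  have hD0 : D ≠ 0 := by
    intro h0
    obtain ⟨e, he, -⟩ := hmiss 0 M.zero_mem (by simp)
    exact hs e he (by rw [← hDK e he, h0]; rfl)
  have hmul : ∀ a b : SignType, a ≠ 0 → b ≠ 0 → (a * b ≠ -1 → b = a) ∧ (a * b ≠ 1 → -b = a) := by
    decide
  have hDM : ∀ X ∈ M.covectors, SignVec.Orthogonal D X := by
    intro X hX
    rw [SignVec.Orthogonal, or_iff_not_imp_right, not_and_or]
    intro h e
    by_cases he : e ∈ K'
    swap
    · rw [hDK' e he, zero_mul]
    rcases h with h | h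
    · push Not at h
      have := key _ (M.neg_mem X hX) (fun f hf hXf => ?_) e he
      · rw [Pi.neg_apply] at this
        rw [(by decide : ∀ a : SignType, -a = 0 → a = 0) _ this, mul_zero]
      · exact (hmul (s f) (X f) (hs f hf) (by simpa using hXf)).2 (by rw [← hDK f hf]; exact h f)
    · push Not at h
      rw [key X hX (fun f hf hXf => (hmul (s f) (X f) (hs f hf) hXf).1
        (by rw [← hDK f hf]; exact h f)) e he, mul_zero]
  obtain ⟨C, hC, hCD⟩ := exists_isSignedCircuit_support_subset hD0 hDM
  exact ⟨C, hC, (hCD.trans hsupp).trans hK'K⟩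

/-- Shattered sets are independent. -/
theorem Shatters.not_support_subset {M : OrientedMatroid E} {K : Set E} (hK : M.Shatters ∅ K)
    {C : E → SignType} (hC : C ≠ 0) (hM : ∀ X ∈ M.covectors, SignVec.Orthogonal C X) :
    ¬ Function.support C ⊆ K := by
  intro hsub
  obtain ⟨X, hX, -, hXC⟩ := hK.mono hsub C fun e he => he
  have hsq : ∀ e, C e * X e ≠ -1 := fun e => by
    by_cases he : C e = 0
    · rw [he, zero_mul]
      decide
    · rw [hXC e he]
      cases C e <;> decide
  rcases hM X hX with h | ⟨-, e, he⟩
  · refine hC (funext fun e => ?_)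
    by_contra he
    have := h e
    rw [hXC e he] at this
    exact he (by simpa using this)
  · exact hsq e he

/-- The support of a sign vector, as a finset. -/
def signSupport [Fintype E] (C : E → SignType) : Finset E := Finset.univ.filter fun e => C e ≠ 0

theorem mem_signSupport [Fintype E] {C : E → SignType} {e : E} : e ∈ signSupport C ↔ C e ≠ 0 := by
  simp [signSupport]

theorem circuitPoly_eq [Fintype E] [DecidableEq E] (C : E → SignType) :
    circuitPoly C = ∑ k ∈ signSupport C,
      MvPolynomial.C (C k : ℤ) * ∏ i ∈ (signSupport C).erase k, MvPolynomial.X i := by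
  unfold circuitPoly signSupport
  congr!

/-- The straightening algorithm: a family indexed by the sets of size `p` that satisfies the
relations of the Cordovil algebra modulo `W` lies in `W` as soon as its members indexed by no
broken circuit sets do. A broken circuit in `S` allows to rewrite `S` through sets in which the
least element of the circuit has replaced a larger one. -/
theorem mem_of_isNBC_of_circuit_relations [Fintype E] [DecidableEq E] (M : OrientedMatroid E)
    {r : E → ℕ} (hr : Function.Injective r) {V : Type*} [AddCommGroup V] (W : Submodule ℤ V)
    (φ : Finset E → V) (p : ℕ)
    (hφ : ∀ C, M.IsSignedCircuit C → ∀ A : Finset E, A.card + (signSupport C).card = p + 1 →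
      ∑ k ∈ signSupport C, (C k : ℤ) • (if Disjoint A ((signSupport C).erase k) then
        φ (A ∪ (signSupport C).erase k) else 0) ∈ W)
    (hW : ∀ S, S.card = p → M.IsNBC r ∅ Finset.univ S → φ S ∈ W) (S : Finset E)
    (hS : S.card = p) : φ S ∈ W := by
  induction hn : ∑ e ∈ S, r e using Nat.strong_induction_on generalizing S with
  | _ n ih =>
    by_cases hnbc : M.IsNBC r ∅ Finset.univ S
    · exact hW S hS hnbc
    simp only [IsNBC, Finset.subset_univ, true_and, Finset.mem_univ, forall_const, not_forall,
      Finset.coe_empty] at hnbc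
    obtain ⟨m, hm⟩ := hnbc
    obtain ⟨C, hC, hCm⟩ := exists_isSignedCircuit_of_not_shatters hm
    set K := signSupport C with hKdef
    have hKne : K.Nonempty := by
      by_contra h
      rw [Finset.not_nonempty_iff_eq_empty] at h
      refine hC.1.1 (funext fun e => ?_)
      by_contra he
      exact Finset.notMem_empty e (h ▸ mem_signSupport.2 he)
    obtain ⟨μ, hμ, hmin⟩ := K.exists_min_image r hKne
    have hmK : ∀ e ∈ K, e = m ∨ e ∈ S ∧ r m < r e := fun e he => hCm (mem_signSupport.1 he)
    have hKS : K.erase μ ⊆ S := fun e he => by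
      obtain ⟨hne, heK⟩ := Finset.mem_erase.1 he
      refine ((hmK e heK).resolve_left ?_).1
      rintro rfl
      rcases hmK μ hμ with h | h
      · exact hne h.symm
      · exact absurd (hmin e heK) (not_le.2 h.2)
    set A := S \ K.erase μ with hA
    have hAμ : A ∪ K.erase μ = S := Finset.sdiff_union_of_subset hKS
    have hAd : Disjoint A (K.erase μ) := Finset.sdiff_disjoint
    have hKcard : (K.erase μ).card + 1 = K.card := Finset.card_erase_add_one hμ
    have hAcard : A.card + (K.erase μ).card = S.card := by
      rw [← Finset.card_union_of_disjoint hAd, hAμ]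
    have hrel := hφ C hC A (by rw [← hKdef]; omega)
    rw [← Finset.add_sum_erase _ _ hμ, if_pos hAd, hAμ] at hrel
    have hrest : ∑ k ∈ K.erase μ, (C k : ℤ) • (if Disjoint A (K.erase k) then
        φ (A ∪ K.erase k) else 0) ∈ W := by
      refine W.sum_mem fun k hk => W.smul_mem _ ?_
      obtain ⟨hkμ, hkK⟩ := Finset.mem_erase.1 hk
      split_ifs with hd
      · have hkcard : (K.erase k).card + 1 = K.card := Finset.card_erase_add_one hkK
        refine ih _ ?_ _ (by rw [Finset.card_union_of_disjoint hd]; omega) rfl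
        have h1 := Finset.sum_erase_add K r hkK
        have h2 := Finset.sum_erase_add K r hμ
        have h3 : r μ < r k := lt_of_le_of_ne (hmin k hkK) fun h => hkμ (hr h).symm
        rw [Finset.sum_union hd, ← hn, ← hAμ, Finset.sum_union hAd]
        omega
      · exact W.zero_mem
    have hlead := (W.add_mem_iff_left hrest).1 hrel
    have hμ0 : C μ ≠ 0 := mem_signSupport.1 hμ
    cases h : C μ
    · exact absurd h hμ0
    · rw [h] at hlead
      simpa using hlead
    · rw [h] at hlead
      simpa using hlead

end OrientedMatroid

/-! ### Heaviside monomials on the topes -/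

namespace OrientedMatroid

variable {E : Type u}

theorem exists_ne_zero_of_loopless [Finite E] {M : OrientedMatroid E} (hM : M.Loopless) :
    ∃ X ∈ M.covectors, ∀ e, X e ≠ 0 := by
  classical
  have := Fintype.ofFinite E
  suffices ∀ K : Finset E, ∃ X ∈ M.covectors, ∀ e ∈ K, X e ≠ 0 by
    simpa using this Finset.univ
  intro K
  induction K using Finset.induction_on with
  | empty => exact ⟨0, M.zero_mem, by simp⟩
  | insert a K _ ih =>
    obtain ⟨X, hX, hXK⟩ := ih
    obtain ⟨Y, hY, hYa⟩ := hM a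
    refine ⟨_, M.comp_mem X hX Y hY, fun e he => ?_⟩
    by_cases h0 : X e = 0
    · rcases Finset.mem_insert.1 he with rfl | he
      · simpa [SignVec.comp, h0] using hYa
      · exact absurd h0 (hXK e he)
    · simp [SignVec.comp, h0]

/-- The topes of a loopless oriented matroid are the nowhere zero covectors. -/
theorem mem_topes_iff [Finite E] {M : OrientedMatroid E} (hM : M.Loopless) {T : E → SignType} :
    T ∈ M.topes ↔ T ∈ M.covectors ∧ ∀ e, T e ≠ 0 := by
  refine ⟨fun ⟨hT, hmax⟩ => ⟨hT, fun e => ?_⟩,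
    fun ⟨hT, hne⟩ => ⟨hT, fun Y _ hTY => funext fun e => hTY e (hne e)⟩⟩
  obtain ⟨X, hX, hXne⟩ := exists_ne_zero_of_loopless hM
  have h := hmax _ (M.comp_mem T hT X hX) fun e he => by simp [SignVec.comp, he]
  rw [← h]
  by_cases h0 : T e = 0
  · simpa [SignVec.comp, h0] using hXne e
  · simp [SignVec.comp, h0]

/-- The product of the Heaviside functions of the elements of `S`, in the Varchenko–Gelfand
ring. -/
def topeMono (M : OrientedMatroid E) (S : Finset E) : M.topes → ℤ :=
  fun T => heavisideMono S T.1

/-- The span of the products of fewer than `n` Heaviside functions. Indexing by a strict bound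
makes the annihilator of `monoSpan n` the `n`-th step of the dual filtration for all `n`,
including `n = 0`. -/
def monoSpan (M : OrientedMatroid E) (n : ℕ) : Submodule ℤ (M.topes → ℤ) :=
  Submodule.span ℤ (M.topeMono '' {S | S.card < n})

theorem topeMono_mem_monoSpan {M : OrientedMatroid E} {n : ℕ} {S : Finset E} (h : S.card < n) :
    M.topeMono S ∈ M.monoSpan n :=
  Submodule.subset_span ⟨S, h, rfl⟩

theorem topeMono_mul [DecidableEq E] (M : OrientedMatroid E) (S T : Finset E) :
    M.topeMono S * M.topeMono T = M.topeMono (S ∪ T) :=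
  funext fun _ => heavisideMono_mul _ _ _

theorem topeMono_mul_mem_monoSpan [DecidableEq E] {M : OrientedMatroid E} {n : ℕ}
    {f : M.topes → ℤ} (hf : f ∈ M.monoSpan n) (S : Finset E) :
    M.topeMono S * f ∈ M.monoSpan (n + S.card) := by
  induction hf using Submodule.span_induction with
  | mem f hf =>
    obtain ⟨T, hT, rfl⟩ := hf
    rw [topeMono_mul]
    have := Finset.card_union_le S T
    have hT' : T.card < n := hT
    exact topeMono_mem_monoSpan (by omega)
  | zero => simp
  | add f g _ _ hf hg =>
    rw [mul_add]
    exact Submodule.add_mem _ hf hg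
  | smul c f _ hf =>
    rw [mul_smul_comm]
    exact Submodule.smul_mem _ _ hf

/-- Every function on the topes is an integral polynomial in the Heaviside functions: the indicator
function of a tope is a product of functions `h_e` and `1 - h_e`. -/
theorem span_range_topeMono [Fintype E] {M : OrientedMatroid E} (hM : M.Loopless) :
    Submodule.span ℤ (Set.range M.topeMono) = ⊤ := by
  classical
  have hle : ∀ n, M.monoSpan n ≤ Submodule.span ℤ (Set.range M.topeMono) := fun n =>
    Submodule.span_mono (Set.image_subset_range _ _)
  have hind : ∀ T : M.topes, Pi.single T (1 : ℤ) ∈ Submodule.span ℤ (Set.range M.topeMono) := by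
    intro T
    have hK : ∀ K : Finset E, (fun T' : M.topes => if ∀ e ∈ K, T'.1 e = T.1 e then (1 : ℤ) else 0) ∈
        M.monoSpan (K.card + 1) := by
      intro K
      induction K using Finset.induction_on with
      | empty =>
        convert topeMono_mem_monoSpan (M := M) (S := ∅) (Nat.lt_succ_self _) using 1
        ext T'
        simp [topeMono, heavisideMono]
      | insert a K ha ih =>
        have h1 := topeMono_mul_mem_monoSpan ih {a}
        rw [Finset.card_insert_of_notMem ha]
        rw [Finset.card_singleton] at h1
        have h2 : M.monoSpan (K.card + 1) ≤ M.monoSpan (K.card + 1 + 1) :=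
          Submodule.span_mono (Set.image_mono fun S (hS : S.card < _) => hS.trans (Nat.lt_succ_self _))
        have hne := ((mem_topes_iff hM).1 T.2).2 a
        by_cases hTa : T.1 a = 1
        · convert h1 using 1
          ext T'
          simp only [Finset.mem_insert, forall_eq_or_imp, hTa, topeMono, heavisideMono,
            Finset.prod_singleton, Pi.mul_apply, ite_and, ite_mul, one_mul, zero_mul]
        · convert Submodule.sub_mem _ (h2 ih) h1 using 1
          ext T'
          have hne' := ((mem_topes_iff hM).1 T'.2).2 a
          have hTa' : T.1 a = -1 := by
            revert hne hTa
            cases T.1 a <;> decide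
          have hT' : T'.1 a = -1 ↔ T'.1 a ≠ 1 := by
            revert hne'
            cases T'.1 a <;> decide
          simp only [Finset.mem_insert, forall_eq_or_imp, hTa', hT', topeMono, heavisideMono,
            Finset.prod_singleton, Pi.mul_apply, Pi.sub_apply, ite_and, ite_mul, one_mul, zero_mul]
          split_ifs <;> simp_all
    convert hle _ (hK Finset.univ) using 1
    ext T'
    simp only [Finset.mem_univ, forall_const, Pi.single_apply]
    exact if_congr (by rw [Subtype.ext_iff, funext_iff]) rfl rfl
  rw [eq_top_iff]
  intro f _
  have : f = ∑ T, f T • Pi.single T (1 : ℤ) := by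
    ext T'
    simp [Finset.sum_apply, Pi.single_apply]
  rw [this]
  exact Submodule.sum_mem _ fun T _ => Submodule.smul_mem _ _ (hind T)

theorem aeval_heaviside_monomial (M : OrientedMatroid E) (m : E →₀ ℕ) (c : ℤ) :
    MvPolynomial.aeval M.heaviside (MvPolynomial.monomial m c) = c • M.topeMono m.support := by
  rw [MvPolynomial.aeval_monomial, Algebra.smul_def]
  congr 1
  ext T
  rw [Finsupp.prod, Finset.prod_apply, topeMono, heavisideMono]
  refine Finset.prod_congr rfl fun e he => ?_
  rw [Pi.pow_apply, heaviside]
  have : m e ≠ 0 := Finsupp.mem_support_iff.1 he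
  split_ifs <;> simp [this]

theorem degreeFiltration_eq (M : OrientedMatroid E) (p : ℕ) :
    M.degreeFiltration p = M.monoSpan (p + 1) := by
  classical
  rw [degreeFiltration, MvPolynomial.restrictTotalDegree, MvPolynomial.restrictSupport_eq_span,
    Submodule.map_span, monoSpan]
  congr 1
  ext f
  simp only [Set.mem_image, Set.mem_ofPred_eq, AlgHom.toLinearMap_apply, exists_exists_and_eq_and,
    aeval_heaviside_monomial, one_smul]
  constructor
  · rintro ⟨m, hm, rfl⟩
    refine ⟨m.support, Nat.lt_succ_of_le (le_trans ?_ hm), rfl⟩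
    rw [Finset.card_eq_sum_ones, Finsupp.sum]
    exact Finset.sum_le_sum fun e he => Nat.one_le_iff_ne_zero.2 (Finsupp.mem_support_iff.1 he)
  · rintro ⟨S, hS, rfl⟩
    have hs : (Finsupp.indicator S fun _ _ => 1 : E →₀ ℕ).support = S := by
      ext i
      simp [Finsupp.indicator_apply]
    refine ⟨Finsupp.indicator S fun _ _ => 1, ?_, by rw [hs]⟩
    rw [Finsupp.sum, hs, Finset.sum_congr rfl (g := fun _ => 1), ← Finset.card_eq_sum_ones]
    · exact Nat.le_of_lt_succ hS
    · intro i hi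
      simp [Finsupp.indicator_apply, hi]

/-- Evaluation of functions on the topes at a chain of topes. -/
noncomputable def chainPairing (M : OrientedMatroid E) (γ : M.topes →₀ ℤ) :
    (M.topes → ℤ) →ₗ[ℤ] ℤ where
  toFun f := Finsupp.linearCombination ℤ f γ
  map_add' f g := by
    simp only [Finsupp.linearCombination_apply, Pi.add_apply, smul_add, Finsupp.sum_add]
  map_smul' c f := by
    simp only [Finsupp.linearCombination_apply, Pi.smul_apply, smul_comm _ c, Finsupp.smul_sum,
      RingHom.id_apply]

theorem chainPairing_apply (M : OrientedMatroid E) (γ : M.topes →₀ ℤ) (f : M.topes → ℤ) :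
    M.chainPairing γ f = γ.sum fun T c => c • f T :=
  rfl

theorem mem_dualFiltration_iff (M : OrientedMatroid E) (p : ℕ) (γ : M.topes →₀ ℤ) :
    γ ∈ M.dualFiltration p ↔ M.monoSpan p ≤ LinearMap.ker (M.chainPairing γ) := by
  cases p with
  | zero => simp [dualFiltration, monoSpan]
  | succ p =>
    simp only [dualFiltration, Submodule.mem_iInf, LinearMap.mem_ker, degreeFiltration_eq]
    rfl

theorem mem_dualFiltration_iff_topeMono (M : OrientedMatroid E) (p : ℕ) (γ : M.topes →₀ ℤ) :
    γ ∈ M.dualFiltration p ↔ ∀ S : Finset E, S.card < p → M.chainPairing γ (M.topeMono S) = 0 := by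
  rw [mem_dualFiltration_iff, monoSpan, Submodule.span_le, Set.image_subset_iff]
  rfl

theorem eq_zero_of_chainPairing_topeMono [Fintype E] {M : OrientedMatroid E} (hM : M.Loopless)
    {γ : M.topes →₀ ℤ} (h : ∀ S, M.chainPairing γ (M.topeMono S) = 0) : γ = 0 := by
  classical
  have hle : Submodule.span ℤ (Set.range M.topeMono) ≤ LinearMap.ker (M.chainPairing γ) := by
    rw [Submodule.span_le]
    rintro _ ⟨S, rfl⟩
    exact h S
  rw [span_range_topeMono hM] at hle
  ext T
  have hT : M.chainPairing γ (Pi.single T 1) = 0 := hle Submodule.mem_top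
  rw [chainPairing_apply, Finsupp.sum_fintype _ _ (by simp)] at hT
  simpa [Pi.single_apply] using hT

/-- The relation of a signed circuit `C` in the Varchenko–Gelfand ring, multiplied by the monomial
of `A`. As no tope agrees with `C` or with `-C` on the support of `C`, the products
`∏_{C = +} h_i ∏_{C = -} (h_i - 1)` and `∏_{C = +} (h_i - 1) ∏_{C = -} h_i` vanish; the leading part
of their difference is the polynomial of `C`. -/
theorem sum_topeMono_circuit_mem [Fintype E] [DecidableEq E] {M : OrientedMatroid E}
    (hM : M.Loopless) {C : E → SignType} (hC : C ≠ 0)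
    (hCM : ∀ X ∈ M.covectors, SignVec.Orthogonal C X) (A : Finset E) {p : ℕ}
    (hp : A.card + (signSupport C).card = p + 1) :
    ∑ k ∈ signSupport C, (C k : ℤ) • (if Disjoint A ((signSupport C).erase k) then
      M.topeMono (A ∪ (signSupport C).erase k) else 0) ∈ M.monoSpan p := by
  set K := signSupport C with hK
  let c₁ : E → ℤ := fun e => if C e = 1 then 0 else -1
  let c₂ : E → ℤ := fun e => if C e = 1 then -1 else 0
  let d : Finset E → ℤ := fun t => ∏ e ∈ K \ t, c₁ e - ∏ e ∈ K \ t, c₂ e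
  have hrel : ∑ t ∈ K.powerset, d t • M.topeMono (A ∪ t) = 0 := by
    ext T
    obtain ⟨hT, hTne⟩ := (mem_topes_iff hM).1 T.2
    have hort : (∃ e, C e * T.1 e = 1) ∧ ∃ e, C e * T.1 e = -1 := by
      refine (hCM T.1 hT).resolve_left fun h => hC (funext fun e => ?_)
      exact ((by decide : ∀ a b : SignType, b ≠ 0 → a * b = 0 → a = 0) _ _ (hTne e) (h e))
    obtain ⟨⟨e₂, h₂⟩, e₁, h₁⟩ := hort
    have hmemK : ∀ e (s : SignType), s ≠ 0 → C e * T.1 e = s → e ∈ K := fun e s hs h =>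
      mem_signSupport.2 fun h0 => hs (by rw [← h, h0, zero_mul])
    have hz₁ : ∏ e ∈ K, ((if T.1 e = 1 then 1 else 0) + c₁ e) = 0 := by
      refine Finset.prod_eq_zero (hmemK e₁ _ (by decide) h₁) ?_
      simp only [c₁]
      revert h₁
      cases C e₁ <;> cases T.1 e₁ <;> decide
    have hz₂ : ∏ e ∈ K, ((if T.1 e = 1 then 1 else 0) + c₂ e) = 0 := by
      refine Finset.prod_eq_zero (hmemK e₂ _ (by decide) h₂) ?_
      simp only [c₂]
      revert h₂
      cases C e₂ <;> cases T.1 e₂ <;> decide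
    rw [Finset.prod_add] at hz₁ hz₂
    have hsub := congrArg (fun z => heavisideMono A T.1 * z) (hz₁.trans hz₂.symm)
    rw [Finset.mul_sum, Finset.mul_sum, ← sub_eq_zero, ← Finset.sum_sub_distrib] at hsub
    rw [Finset.sum_apply, Pi.zero_apply, ← hsub]
    refine Finset.sum_congr rfl fun t _ => ?_
    rw [Pi.smul_apply, ← topeMono_mul, Pi.mul_apply, smul_eq_mul]
    simp only [topeMono, d]
    rw [heavisideMono.eq_1 t]
    ring
  have hinj : Set.InjOn (fun k => K.erase k) K := Finset.erase_injOn K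
  have himg : K.image (fun k => K.erase k) ⊆ K.powerset := fun t ht => by
    obtain ⟨k, -, rfl⟩ := Finset.mem_image.1 ht
    exact Finset.mem_powerset.2 (Finset.erase_subset _ _)
  rw [← Finset.sum_sdiff himg, Finset.sum_image hinj] at hrel
  have hd : ∀ k ∈ K, d (K.erase k) = C k := by
    intro k hk
    have hk0 : C k ≠ 0 := mem_signSupport.1 hk
    have : K \ K.erase k = {k} := by
      rw [Finset.sdiff_erase_self hk]
    simp only [d, this, Finset.prod_singleton, c₁, c₂]
    revert hk0
    cases C k <;> decide
  refine (Submodule.sub_mem_iff_left _ (hrel.symm ▸ Submodule.zero_mem _)).1 ?_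
  rw [add_comm, sub_add_eq_sub_sub, ← Finset.sum_sub_distrib]
  refine Submodule.sub_mem _ (Submodule.sum_mem _ fun k hk => ?_)
    (Submodule.sum_mem _ fun t ht => ?_)
  · rw [hd k hk]
    split_ifs with hdis
    · rw [sub_self]
      exact Submodule.zero_mem _
    · rw [smul_zero, zero_sub]
      refine Submodule.neg_mem _ (Submodule.smul_mem _ _ (topeMono_mem_monoSpan ?_))
      have h1 := Finset.card_erase_add_one hk
      have h2 := Finset.card_union_add_card_inter A (K.erase k)
      have h3 : 0 < (A ∩ K.erase k).card :=
        Finset.card_pos.2 (Finset.not_disjoint_iff_nonempty_inter.1 hdis)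
      omega
  · obtain ⟨ht, hti⟩ := Finset.mem_sdiff.1 ht
    rw [Finset.mem_powerset] at ht
    by_cases htK : t = K
    · simp [d, htK]
    · have hlt : t.card < K.card := Finset.card_lt_card (ht.ssubset_of_ne htK)
      have hne : t.card + 1 ≠ K.card := by
        intro h
        have h1 : (K \ t).card = 1 := by
          rw [Finset.card_sdiff_of_subset ht]
          omega
        obtain ⟨k, hk⟩ := Finset.card_eq_one.1 h1
        have hkK : k ∈ K := (Finset.mem_sdiff.1 (hk ▸ Finset.mem_singleton_self k)).1
        refine hti (Finset.mem_image.2 ⟨k, hkK, ?_⟩)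
        rw [← Finset.sdiff_singleton_eq_erase, ← hk, Finset.sdiff_sdiff_eq_self ht]
      have := Finset.card_union_le A t
      exact Submodule.smul_mem _ _ (topeMono_mem_monoSpan (by omega))

/-- The Heaviside monomials of the no broken circuit sets span the degree filtration. -/
theorem topeMono_mem_span_isNBC [Fintype E] [DecidableEq E] {M : OrientedMatroid E}
    (hM : M.Loopless) {r : E → ℕ} (hr : Function.Injective r) (S : Finset E) :
    M.topeMono S ∈
      Submodule.span ℤ (M.topeMono '' {S' | M.IsNBC r ∅ Finset.univ S' ∧ S'.card ≤ S.card}) := by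
  induction hp : S.card using Nat.strong_induction_on generalizing S with
  | _ p ih =>
    refine mem_of_isNBC_of_circuit_relations M hr _ M.topeMono p (fun C hC A hA => ?_)
      (fun S' hS' hnbc => Submodule.subset_span
        (Set.mem_image_of_mem _ (And.intro hnbc hS'.le))) S hp
    refine Submodule.span_le.2 ?_ (sum_topeMono_circuit_mem hM hC.1.1 hC.1.2 A hA)
    rintro _ ⟨S', hS', rfl⟩
    exact Submodule.span_mono (Set.image_mono fun S'' h => And.intro h.1 (h.2.trans hS'.le))
      (ih _ hS' S' rfl)

/-- The Heaviside monomials of the no broken circuit sets form a basis of the Varchenko–Gelfand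
ring, so functionals on it can be prescribed on them. -/
theorem exists_chainPairing_eq [Fintype E] [DecidableEq E] {M : OrientedMatroid E}
    (hM : M.Loopless) {r : E → ℕ} (hr : Function.Injective r) (a : Finset E → ℤ) :
    ∃ γ : M.topes →₀ ℤ, ∀ S, M.IsNBC r ∅ Finset.univ S →
      M.chainPairing γ (M.topeMono S) = a S := by
  classical
  let v : {S // M.IsNBC r ∅ Finset.univ S} → (M.topes → ℤ) := fun S => M.topeMono S.1
  have hli : LinearIndependent ℤ v := by
    rw [Fintype.linearIndependent_iff]
    intro g hg S
    have key := coeff_eq_zero_of_isNBC M hr Finset.univ ∅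
      (fun S => if h : M.IsNBC r ∅ Finset.univ S then g ⟨S, h⟩ else 0)
      (fun S hS => by by_contra h; simp [h] at hS) (fun X hX _ hXne => ?_) S.1
    · simpa [S.2] using key
    · have := congrFun hg ⟨X, (mem_topes_iff hM).2 ⟨hX, fun e => hXne e (Finset.mem_univ _)⟩⟩
      rw [Finset.sum_apply, Pi.zero_apply] at this
      refine Eq.trans ?_ this
      rw [Finset.powerset_univ]
      simp only [dite_mul, zero_mul, Pi.smul_apply, smul_eq_mul, v, topeMono]
      rw [Finset.sum_dite, Finset.sum_const_zero, add_zero]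
      refine Finset.sum_bij (fun S _ => ⟨S.1, (Finset.mem_filter.1 S.2).2⟩) (by simp) ?_ ?_ ?_
      · intro a _ b _ h
        exact Subtype.ext (Subtype.mk.inj h)
      · intro b _
        exact ⟨⟨b.1, by simpa using b.2⟩, Finset.mem_attach _ _, rfl⟩
      · intro a _
        rfl
  have hspan : ⊤ ≤ Submodule.span ℤ (Set.range v) := by
    rw [← span_range_topeMono hM, Submodule.span_le]
    rintro _ ⟨S, rfl⟩
    refine Submodule.span_mono ?_ (topeMono_mem_span_isNBC hM hr S)
    rintro _ ⟨S', hS', rfl⟩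
    exact ⟨⟨S', hS'.1⟩, rfl⟩
  let b := Module.Basis.mk hli hspan
  let ℓ : (M.topes → ℤ) →ₗ[ℤ] ℤ := b.constr ℤ fun S => a S.1
  refine ⟨Finsupp.equivFunOnFinite.symm fun T => ℓ (Pi.single T 1), fun S hS => ?_⟩
  have hℓ : ℓ (M.topeMono S) = a S := by
    have h1 : ℓ (b ⟨S, hS⟩) = a S := b.constr_basis ℤ _ _
    rwa [Module.Basis.mk_apply] at h1
  rw [chainPairing_apply, Finsupp.sum_fintype _ _ (by simp), ← hℓ]
  have h2 : M.topeMono S = ∑ T, M.topeMono S T • Pi.single T (1 : ℤ) := by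
    ext T'
    simp [Finset.sum_apply, Pi.single_apply]
  conv_rhs => rw [h2, map_sum]
  refine Finset.sum_congr rfl fun T _ => ?_
  rw [map_smul, smul_eq_mul, smul_eq_mul, mul_comm]
  rfl

end OrientedMatroid

/-! ### Square-free monomials and the dual of the Cordovil algebra -/

namespace SFSym

variable {E : Type u}

theorem mono_mul_mono [DecidableEq E] (S T : Finset E) :
    (mono S * mono T : SFSym E) = if Disjoint S T then mono (S ∪ T) else 0 := by
  rw [mono, mono, ← map_mul]
  split_ifs with h
  · rw [← Finset.prod_union h, mono]
  · obtain ⟨i, hS, hT⟩ := Finset.not_disjoint_iff.1 h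
    rw [Ideal.Quotient.eq_zero_iff_mem, ← Finset.mul_prod_erase S _ hS,
      ← Finset.mul_prod_erase T _ hT]
    rw [show ∀ x a b : MvPolynomial E ℤ, x * a * (x * b) = a * b * x ^ 2 by intros; ring]
    exact Ideal.mul_mem_left _ _ (Ideal.subset_span ⟨i, rfl⟩)

/-- A monomial is either not square-free, and vanishes in `SFSym E`, or a multiple of some `x^S`. -/
theorem mk_monomial_mem (m : E →₀ ℕ) (c : ℤ) :
    ∃ (S : Finset E) (c' : ℤ),
      (Ideal.Quotient.mk _ (MvPolynomial.monomial m c) : SFSym E) = c' • mono S := by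
  by_cases h : ∀ i, m i ≤ 1
  · refine ⟨m.support, c, ?_⟩
    rw [mono, ← map_zsmul, MvPolynomial.monomial_eq, Finsupp.prod, MvPolynomial.C_mul',
      Finset.prod_congr rfl fun i hi => ?_]
    have : m i ≠ 0 := Finsupp.mem_support_iff.1 hi
    rw [show m i = 1 by have := h i; omega, pow_one]
  · push Not at h
    obtain ⟨i, hi⟩ := h
    refine ⟨∅, 0, ?_⟩
    rw [zero_smul, Ideal.Quotient.eq_zero_iff_mem]
    have : m = (m - Finsupp.single i 2) + Finsupp.single i 2 := by
      ext j
      by_cases hj : i = j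
      · subst hj
        simp
        omega
      · simp [hj]
    rw [this, ← mul_one c, ← MvPolynomial.monomial_mul, ← MvPolynomial.X_pow_eq_monomial]
    exact Ideal.mul_mem_left _ _ (Ideal.subset_span ⟨i, rfl⟩)

/-- The square-free monomials span. -/
theorem eq_sum_coeff_smul_mono [Fintype E] (a : SFSym E) : a = ∑ S, coeff S a • mono S := by
  classical
  have h0 : ∀ (S : Finset E) (c : ℤ), c • mono S = ∑ T, coeff T (c • mono S) • mono T := by
    intro S c
    simp only [map_smul, coeff_mono, smul_eq_mul, mul_ite, mul_one, mul_zero, ite_smul, zero_smul,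
      Finset.sum_ite_eq', Finset.mem_univ, if_true]
  obtain ⟨q, rfl⟩ := Ideal.Quotient.mk_surjective a
  induction q using MvPolynomial.induction_on' with
  | monomial m c =>
    obtain ⟨S, c', h⟩ := mk_monomial_mem m c
    rw [h]
    exact h0 S c'
  | add p q hp hq =>
    rw [map_add]
    simp only [map_add, add_smul, Finset.sum_add_distrib]
    rw [← hp, ← hq]

theorem ext_coeff [Fintype E] {a b : SFSym E} (h : ∀ S, coeff S a = coeff S b) : a = b := by
  rw [eq_sum_coeff_smul_mono a, eq_sum_coeff_smul_mono b]
  simp only [h]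

theorem pairing_comm [Fintype E] (a b : SFSym E) : pairing a b = pairing b a := by
  simp only [pairing, LinearMap.sum_apply, LinearMap.smul_apply, smul_eq_mul, mul_comm]

theorem pairing_mono [Fintype E] (a : SFSym E) (S : Finset E) :
    pairing a (mono S) = coeff S a := by
  classical
  simp [pairing, LinearMap.sum_apply, coeff_mono]

theorem mem_span_mono_iff [Fintype E] {p : ℕ} {a : SFSym E} :
    a ∈ Submodule.span ℤ {a : SFSym E | ∃ S : Finset E, S.card = p ∧ a = mono S} ↔
      ∀ S : Finset E, S.card ≠ p → coeff S a = 0 := by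
  classical
  refine ⟨fun h S hS => ?_, fun h => ?_⟩
  · induction h using Submodule.span_induction with
    | mem x hx =>
      obtain ⟨T, hT, rfl⟩ := hx
      rw [coeff_mono, if_neg]
      rintro rfl
      exact hS hT
    | zero => simp
    | add x y _ _ hx hy => rw [map_add, hx, hy, add_zero]
    | smul c x _ hx => rw [map_smul, hx, smul_zero]
  · rw [eq_sum_coeff_smul_mono a]
    refine Submodule.sum_mem _ fun S _ => ?_
    by_cases hS : S.card = p
    · exact Submodule.smul_mem _ _ (Submodule.subset_span ⟨S, hS, rfl⟩)
    · rw [h S hS, zero_smul]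
      exact Submodule.zero_mem _

end SFSym

namespace OrientedMatroid

variable {E : Type u}

theorem pairing_mono_mul_circuitPoly [Fintype E] [DecidableEq E] (C : E → SignType) (A : Finset E)
    (a : SFSym E) :
    SFSym.pairing a (SFSym.mono A * Ideal.Quotient.mk _ (circuitPoly C)) =
      ∑ k ∈ signSupport C, (C k : ℤ) • (if Disjoint A ((signSupport C).erase k) then
        SFSym.coeff (A ∪ (signSupport C).erase k) a else 0) := by
  have : (SFSym.mono A * Ideal.Quotient.mk _ (circuitPoly C) : SFSym E) =
      ∑ k ∈ signSupport C, (C k : ℤ) • (SFSym.mono A * SFSym.mono ((signSupport C).erase k)) := by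
    rw [circuitPoly_eq, map_sum, Finset.mul_sum]
    refine Finset.sum_congr rfl fun k _ => ?_
    rw [MvPolynomial.C_mul', map_zsmul, mul_smul_comm]
    rfl
  rw [this, map_sum]
  refine Finset.sum_congr rfl fun k _ => ?_
  rw [map_smul, SFSym.mono_mul_mono]
  split_ifs
  · rw [SFSym.pairing_mono]
  · rw [map_zero]

/-- The dual of the Cordovil algebra in coordinates: the coefficients of an element satisfy the
relations of the monomial multiples of the circuit polynomials. -/
theorem mem_cordovilDual_iff [Fintype E] [DecidableEq E] (M : OrientedMatroid E) (p : ℕ)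
    (a : SFSym E) :
    a ∈ M.cordovilDual p ↔ (∀ S : Finset E, S.card ≠ p → SFSym.coeff S a = 0) ∧
      ∀ C, M.IsSignedCircuit C → ∀ A : Finset E, A.card + (signSupport C).card = p + 1 →
        ∑ k ∈ signSupport C, (C k : ℤ) • (if Disjoint A ((signSupport C).erase k) then
          SFSym.coeff (A ∪ (signSupport C).erase k) a else 0) = 0 := by
  simp only [cordovilDual, Submodule.mem_inf, SFSym.mem_span_mono_iff, Submodule.mem_iInf,
    LinearMap.mem_ker]
  refine and_congr_right fun hp => ⟨fun h C hC A _ => ?_, fun h q hq => ?_⟩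
  · rw [← pairing_mono_mul_circuitPoly, SFSym.mono, ← map_mul, SFSym.pairing_comm]
    have hCI : circuitPoly C ∈ M.cordovilIdeal := 
      Ideal.subset_span (Or.inr ⟨C, hC, rfl⟩)
    exact h _ (Ideal.mul_mem_left _ _ hCI)
  · suffices ∀ s : MvPolynomial E ℤ, SFSym.pairing a (Ideal.Quotient.mk _ (s * q)) = 0 by
      rw [SFSym.pairing_comm, ← one_mul q]
      exact this 1
    rw [cordovilIdeal] at hq
    induction hq using Submodule.span_induction with
    | mem q hq =>
      intro s
      rcases hq with ⟨i, rfl⟩ | ⟨C, hC, rfl⟩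
      · have hi : (Ideal.Quotient.mk _ (s * MvPolynomial.X i ^ 2) : SFSym E) = 0 :=
          Ideal.Quotient.eq_zero_iff_mem.2 (Ideal.mul_mem_left _ _ (Ideal.subset_span ⟨i, rfl⟩))
        rw [hi, map_zero]
      · induction s using MvPolynomial.induction_on' with
        | monomial m c =>
          obtain ⟨A, c', hA⟩ := SFSym.mk_monomial_mem m c
          rw [map_mul, hA, smul_mul_assoc, map_smul, pairing_mono_mul_circuitPoly]
          by_cases hcard : A.card + (signSupport C).card = p + 1
          · rw [h C hC A hcard, smul_zero]
          · rw [Finset.sum_eq_zero, smul_zero]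
            intro k hk
            split_ifs with hd
            · rw [hp, smul_zero]
              have := Finset.card_erase_add_one hk
              rw [Finset.card_union_of_disjoint hd]
              omega
            · rw [smul_zero]
        | add s t hs ht => rw [add_mul, map_add, map_add, hs, ht, add_zero]
    | zero => simp
    | add q q' _ _ hq hq' =>
      intro s
      rw [mul_add, map_add, map_add, hq, hq', add_zero]
    | smul t q _ hq =>
      intro s
      rw [smul_eq_mul, ← mul_assoc]
      exact hq _

/-! ### The leading part map -/

/-- The map that sends a chain `γ` of sign vectors to `∑_S ⟨h_S, γ⟩ x^S`, where `S` runs over the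
sets of size `p`. On `P_p` it pairs `γ` with the leading parts of polynomials of degree `p`. -/
noncomputable def leadingPart (E : Type u) [Fintype E] (p : ℕ) :
    ((E → SignType) →₀ ℤ) →ₗ[ℤ] SFSym E :=
  ∑ S ∈ Finset.univ.filter (fun S : Finset E => S.card = p),
    (Finsupp.linearCombination ℤ (heavisideMono S)).smulRight (SFSym.mono S)

theorem coeff_leadingPart [Fintype E] (p : ℕ) (S : Finset E) (γ : (E → SignType) →₀ ℤ) :
    SFSym.coeff S (leadingPart E p γ) =
      if S.card = p then Finsupp.linearCombination ℤ (heavisideMono S) γ else 0 := by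
  classical
  simp only [leadingPart, LinearMap.sum_apply, LinearMap.smulRight_apply, map_sum, map_smul,
    SFSym.coeff_mono, smul_eq_mul, mul_ite, mul_one, mul_zero, Finset.sum_ite_eq, Finset.mem_filter,
    Finset.mem_univ, true_and]

theorem linearCombination_topeIncl (M : OrientedMatroid E) (S : Finset E) (γ : M.topes →₀ ℤ) :
    Finsupp.linearCombination ℤ (heavisideMono S) (M.topeIncl γ) =
      M.chainPairing γ (M.topeMono S) :=
  Finsupp.linearCombination_mapDomain ℤ _ _

theorem leadingPart_mem_cordovilDual [Fintype E] {M : OrientedMatroid E} (hM : M.Loopless) {p : ℕ}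
    {γ : M.topes →₀ ℤ} (hγ : γ ∈ M.dualFiltration p) :
    leadingPart E p (M.topeIncl γ) ∈ M.cordovilDual p := by
  classical
  rw [mem_dualFiltration_iff] at hγ
  rw [mem_cordovilDual_iff]
  refine ⟨fun S hS => by rw [coeff_leadingPart, if_neg hS], fun C hC A hA => ?_⟩
  have h := hγ (sum_topeMono_circuit_mem hM hC.1.1 hC.1.2 A hA)
  rw [LinearMap.mem_ker, map_sum] at h
  refine Eq.trans (Finset.sum_congr rfl fun k hk => ?_) h
  rw [map_smul]
  split_ifs with hd
  · have := Finset.card_erase_add_one hk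
    rw [coeff_leadingPart, if_pos (by rw [Finset.card_union_of_disjoint hd]; omega),
      linearCombination_topeIncl]
  · rw [map_zero]

/-- The kernel of the leading part map on `P_p` is `P_{p+1}`. -/
theorem leadingPart_eq_zero_iff [Fintype E] {M : OrientedMatroid E} {p : ℕ}
    {γ : M.topes →₀ ℤ} (hγ : γ ∈ M.dualFiltration p) :
    leadingPart E p (M.topeIncl γ) = 0 ↔ γ ∈ M.dualFiltration (p + 1) := by
  rw [mem_dualFiltration_iff_topeMono] at hγ ⊢
  refine ⟨fun h S hS => ?_, fun h => SFSym.ext_coeff fun S => ?_⟩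
  · rcases Nat.lt_succ_iff_lt_or_eq.1 hS with hS | hS
    · exact hγ S hS
    · have := congrArg (SFSym.coeff S) h
      rwa [coeff_leadingPart, if_pos hS, linearCombination_topeIncl, map_zero] at this
  · rw [coeff_leadingPart, map_zero, linearCombination_topeIncl]
    split_ifs with hS
    · exact h S (by omega)
    · rfl

/-- The leading part map from `P_p` to `A_p` is surjective: a chain can be chosen to have prescribed
pairings with the Heaviside monomials of the no broken circuit sets, and both membership in `P_p`
and an element of `A_p` are determined on no broken circuit sets. -/
theorem exists_leadingPart_eq [Fintype E] {M : OrientedMatroid E} (hM : M.Loopless) {p : ℕ}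
    {a : SFSym E} (ha : a ∈ M.cordovilDual p) :
    ∃ γ ∈ M.dualFiltration p, leadingPart E p (M.topeIncl γ) = a := by
  classical
  let r : E → ℕ := fun e => Fintype.equivFin E e
  have hr : Function.Injective r := Fin.val_injective.comp (Fintype.equivFin E).injective
  obtain ⟨γ, hγ⟩ := exists_chainPairing_eq hM hr fun S => SFSym.coeff S a
  have hγp : γ ∈ M.dualFiltration p := by
    rw [mem_dualFiltration_iff_topeMono]
    intro S hS
    suffices Submodule.span ℤ (M.topeMono '' {S' | M.IsNBC r ∅ Finset.univ S' ∧
        S'.card ≤ S.card}) ≤ LinearMap.ker (M.chainPairing γ) from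
      this (topeMono_mem_span_isNBC hM hr S)
    rw [Submodule.span_le]
    rintro _ ⟨S', ⟨hnbc, hS'⟩, rfl⟩
    exact (hγ S' hnbc).trans (((mem_cordovilDual_iff M p a).1 ha).1 S' (by omega))
  refine ⟨γ, hγp, ?_⟩
  have hdiff := Submodule.sub_mem _ (leadingPart_mem_cordovilDual hM hγp) ha
  rw [← sub_eq_zero]
  obtain ⟨h1, h2⟩ := (mem_cordovilDual_iff M p _).1 hdiff
  refine SFSym.ext_coeff fun S => ?_
  rw [map_zero]
  by_cases hS : S.card = p
  · refine (Submodule.mem_bot ℤ).1 (mem_of_isNBC_of_circuit_relations M hr ⊥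
      (fun S => SFSym.coeff S (leadingPart E p (M.topeIncl γ) - a)) p
      (fun C hC A hA => (Submodule.mem_bot ℤ).2 (h2 C hC A hA)) (fun S hS hnbc => ?_) S hS)
    rw [Submodule.mem_bot, map_sub, coeff_leadingPart, if_pos hS, linearCombination_topeIncl,
      hγ S hnbc, sub_self]
  · exact h1 S hS

end OrientedMatroid

/-! ### Initial oriented matroids -/

namespace OrientedMatroid

variable {E : Type u} {M : OrientedMatroid E}

theorem FlatFlag.exists_mem_block (F : M.FlatFlag) (e : E) :
    ∃ i : Fin F.length, e ∈ F.flat i.succ \ F.flat i.castSucc := by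
  by_contra! h
  have : ∀ i, e ∈ F.flat i := fun i => by
    induction i using Fin.reverseInduction with
    | last => rw [F.flat_last]; trivial
    | cast i ih => exact not_not.1 fun hi => h i ⟨ih, hi⟩
  exact (Set.mem_empty_iff_false e).1 (F.flat_zero ▸ this 0)

theorem FlatFlag.block_unique (F : M.FlatFlag) {e : E} {i j : Fin F.length}
    (hi : e ∈ F.flat i.succ \ F.flat i.castSucc) (hj : e ∈ F.flat j.succ \ F.flat j.castSucc) :
    i = j := by
  have key : ∀ {i j : Fin F.length}, e ∈ F.flat i.succ \ F.flat i.castSucc →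
      e ∈ F.flat j.succ \ F.flat j.castSucc → ¬ i < j := fun hi hj hlt =>
    hj.2 (F.strictMono.monotone (Fin.succ_le_castSucc_iff.2 hlt) hi.1)
  exact le_antisymm (not_lt.1 (key hj hi)) (not_lt.1 (key hi hj))

/-- Flats provide covectors that are nonzero exactly outside them, so the minors of a flag of flats
have no loops. -/
theorem initial_loopless (F : M.FlatFlag) : (M.initial F).Loopless := by
  choose i hi using F.exists_mem_block
  choose Y hY hYF using F.isFlat
  refine fun e => ⟨fun f => Y (i f).castSucc f, fun j => ?_, fun h => ?_⟩
  · refine ⟨Y j.castSucc, hY _, fun f hf => ?_, fun f => ?_⟩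
    · rw [hYF] at hf
      exact hf
    · change Y (i f).castSucc f = _
      rw [F.block_unique (hi f) f.2]
  · refine (hi e).2 ?_
    rw [hYF]
    exact h

/-- The covectors of consecutive minors given by a nowhere zero covector of an initial oriented
matroid combine to a covector of `M`; in the composition the later minors come first, as their
covectors vanish on the earlier blocks. -/
theorem exists_covector_of_mem_initial {F : M.FlatFlag} {T : E → SignType}
    (hT : T ∈ (M.initial F).covectors) (hne : ∀ e, T e ≠ 0) (i j : Fin (F.length + 1))
    (hij : i ≤ j) :
    ∃ Y ∈ M.covectors, (∀ e ∈ F.flat i, Y e = 0) ∧ ∀ e ∈ F.flat j \ F.flat i, Y e = T e := by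
  induction j using Fin.induction with
  | zero =>
    refine ⟨0, M.zero_mem, fun _ _ => rfl, fun e he => ?_⟩
    exact absurd (F.flat_zero ▸ he.1) (Set.notMem_empty e)
  | succ j ih =>
    rcases hij.eq_or_lt with rfl | hlt
    · exact ⟨0, M.zero_mem, fun _ _ => rfl, fun e he => absurd he.1 he.2⟩
    have hij' : i ≤ j.castSucc := Fin.le_castSucc_iff.2 hlt
    obtain ⟨Y, hY, hY0, hYT⟩ := ih hij'
    obtain ⟨Z, hZ, hZ0, hZT⟩ := hT j
    refine ⟨_, M.comp_mem Z hZ Y hY, fun e he => ?_, fun e he => ?_⟩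
    · simp [SignVec.comp, hZ0 e (F.strictMono.monotone hij' he), hY0 e he]
    · by_cases hej : e ∈ F.flat j.castSucc
      · simp [SignVec.comp, hZ0 e hej, hYT e ⟨hej, he.2⟩]
      · have : Z e = T e := (hZT ⟨e, he.1, hej⟩).symm
        simp [SignVec.comp, this, hne e]

theorem topes_initial_anti [Finite E] {F' F : M.FlatFlag} (h : F' ≤ F) :
    (M.initial F).topes ⊆ (M.initial F').topes := by
  intro T hT
  rw [mem_topes_iff (initial_loopless _)] at hT ⊢
  refine ⟨fun i => ?_, hT.2⟩
  have hsub := FlatFlag.le_iff.1 h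
  obtain ⟨a, ha⟩ := hsub ⟨i.castSucc, rfl⟩
  obtain ⟨b, hb⟩ := hsub ⟨i.succ, rfl⟩
  have hab : a ≤ b := by
    rw [← F.strictMono.le_iff_le, ha, hb]
    exact F'.strictMono.monotone (Fin.castSucc_le_succ i)
  obtain ⟨Y, hY, hY0, hYT⟩ := exists_covector_of_mem_initial hT.1 hT.2 a b hab
  rw [ha] at hY0 hYT
  rw [hb] at hYT
  exact ⟨Y, hY, hY0, fun e => (hYT e e.2).symm⟩

/-- A circuit of `M` contains a dependent set of each initial oriented matroid: its part in the last
block that it meets. -/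
theorem exists_orthogonal_initial (F : M.FlatFlag) {C : E → SignType} (hC : C ≠ 0)
    (hCM : ∀ X ∈ M.covectors, SignVec.Orthogonal C X) :
    ∃ D, D ≠ 0 ∧ (∀ X ∈ (M.initial F).covectors, SignVec.Orthogonal D X) ∧
      Function.support D ⊆ Function.support C := by
  classical
  obtain ⟨i, hi, hne⟩ : ∃ i : Fin F.length, Function.support C ⊆ F.flat i.succ ∧
      ¬ Function.support C ⊆ F.flat i.castSucc := by
    by_contra! h
    have : ∀ i, Function.support C ⊆ F.flat i := fun i => by
      induction i using Fin.reverseInduction with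
      | last => rw [F.flat_last]; exact Set.subset_univ _
      | cast i ih => exact h i ih
    have h0 := this 0
    rw [F.flat_zero, Set.subset_empty_iff, Function.support_eq_empty_iff] at h0
    exact hC h0
  obtain ⟨e, heC, heF⟩ := Set.not_subset.1 hne
  refine ⟨fun e => if e ∈ F.flat i.castSucc then 0 else C e, fun h0 => heC ?_, fun X hX => ?_,
    fun f hf => ?_⟩
  · simpa [heF] using congrFun h0 e
  · obtain ⟨Y, hY, hY0, hYX⟩ := hX i
    have heq : ∀ f, (if f ∈ F.flat i.castSucc then 0 else C f) * X f = C f * Y f := by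
      intro f
      by_cases hf : f ∈ F.flat i.castSucc
      · rw [if_pos hf, hY0 f hf, zero_mul, mul_zero]
      · rw [if_neg hf]
        by_cases hfC : C f = 0
        · rw [hfC, zero_mul, zero_mul]
        · rw [show X f = Y f from hYX ⟨f, hi hfC, hf⟩]
    simp only [SignVec.Orthogonal, heq]
    exact hCM Y hY
  · rw [Function.mem_support] at hf ⊢
    intro h
    simp [h] at hf

theorem card_le_rank_of_isNBC_initial [Fintype E] (F : M.FlatFlag) {r : E → ℕ}
    (hr : Function.Injective r) {S : Finset E}
    (hS : (M.initial F).IsNBC r ∅ Finset.univ S) : S.card ≤ M.rank := by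
  classical
  rcases S.eq_empty_or_nonempty with rfl | ⟨e, he⟩
  · exact Nat.zero_le _
  have hsh := hS.shatters hr ⟨e, Finset.mem_univ e⟩
  rw [Finset.coe_empty] at hsh
  refine Finset.le_sup (f := Finset.card)
    (Finset.mem_filter.2 ⟨Finset.mem_univ S, fun C hC hCS => ?_⟩)
  obtain ⟨D, hD, hDM, hDC⟩ := exists_orthogonal_initial F hC.1.1 hC.1.2
  exact hsh.not_support_subset hD hDM (hDC.trans hCS)

/-! ### The stalks -/

/-- Chains of topes of `M_F` are chains of topes of `M_{F'}` if `σ_{F'} ⊆ σ_F`. -/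
theorem exists_topeIncl_eq [Finite E] {F' F : M.FlatFlag} (h : F' ≤ F)
    (γ : (M.initial F).topes →₀ ℤ) :
    ∃ γ' : (M.initial F').topes →₀ ℤ, (M.initial F').topeIncl γ' = (M.initial F).topeIncl γ :=
  ⟨γ.mapDomain (Set.inclusion (topes_initial_anti h)), (Finsupp.mapDomain_comp ..).symm⟩

theorem signStalk_antitone [Finite E] (M : OrientedMatroid E) : Antitone M.signStalk := by
  rintro F' F h _ ⟨γ, rfl⟩
  obtain ⟨γ', hγ'⟩ := exists_topeIncl_eq h γ
  exact ⟨γ', hγ'⟩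

theorem vgStalk_antitone [Finite E] (M : OrientedMatroid E) (p : ℕ) : Antitone (M.vgStalk p) := by
  rintro F' F h _ ⟨γ, hγ, rfl⟩
  obtain ⟨γ', hγ'⟩ := exists_topeIncl_eq h γ
  refine ⟨γ', (mem_dualFiltration_iff_topeMono _ _ _).2 fun S hS => ?_, hγ'⟩
  rw [← linearCombination_topeIncl, hγ', linearCombination_topeIncl]
  exact (mem_dualFiltration_iff_topeMono _ _ _).1 hγ S hS

theorem leadingPart_mem_cordovilStalk [Fintype E] {p : ℕ} {F : M.FlatFlag}
    {x : (E → SignType) →₀ ℤ} (hx : x ∈ M.vgStalk p F) :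
    leadingPart E p x ∈ M.cordovilStalk p F := by
  obtain ⟨γ, hγ, rfl⟩ := hx
  exact leadingPart_mem_cordovilDual (initial_loopless F) hγ

theorem exists_leadingPart_eq_of_mem_cordovilStalk [Fintype E] {p : ℕ} {F : M.FlatFlag}
    {a : SFSym E} (ha : a ∈ M.cordovilStalk p F) : ∃ x ∈ M.vgStalk p F, leadingPart E p x = a := by
  obtain ⟨γ, hγ, h⟩ := exists_leadingPart_eq (initial_loopless F) ha
  exact ⟨_, ⟨γ, hγ, rfl⟩, h⟩

/-- The inclusions of the dual Cordovil modules follow from those of the `P_p`, since the leading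
part maps are surjective and given by the same formula on all stalks. -/
theorem cordovilStalk_antitone [Fintype E] (M : OrientedMatroid E) (p : ℕ) :
    Antitone (M.cordovilStalk p) := by
  intro F' F h a ha
  obtain ⟨x, hx, rfl⟩ := exists_leadingPart_eq_of_mem_cordovilStalk ha
  exact leadingPart_mem_cordovilStalk (vgStalk_antitone M p h hx)

theorem vgStalk_succ_le (M : OrientedMatroid E) (p : ℕ) (F : M.FlatFlag) :
    M.vgStalk (p + 1) F ≤ M.vgStalk p F := by
  refine Submodule.map_mono fun γ hγ => ?_
  rw [mem_dualFiltration_iff_topeMono] at hγ ⊢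
  exact fun S hS => hγ S (hS.trans (Nat.lt_succ_self p))

theorem vgStalk_zero (M : OrientedMatroid E) : M.vgStalk 0 = M.signStalk :=
  funext fun F => by rw [vgStalk, dualFiltration, Submodule.map_top, signStalk]

theorem leadingPart_eq_zero_iff_mem_vgStalk [Fintype E] {p : ℕ} {F : M.FlatFlag}
    {x : (E → SignType) →₀ ℤ} (hx : x ∈ M.vgStalk p F) :
    leadingPart E p x = 0 ↔ x ∈ M.vgStalk (p + 1) F := by
  obtain ⟨γ, hγ, rfl⟩ := hx
  rw [leadingPart_eq_zero_iff hγ, vgStalk, Submodule.mem_map]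
  have hinj : Function.Injective (M.initial F).topeIncl :=
    Finsupp.mapDomain_injective Subtype.val_injective
  exact ⟨fun h => ⟨γ, h, rfl⟩, fun ⟨γ', h, he⟩ => hinj he ▸ h⟩

theorem vgStalk_rank_succ [Fintype E] (M : OrientedMatroid E) (F : M.FlatFlag) :
    M.vgStalk (M.rank + 1) F = ⊥ := by
  classical
  let r : E → ℕ := fun e => Fintype.equivFin E e
  have hr : Function.Injective r := Fin.val_injective.comp (Fintype.equivFin E).injective
  rw [eq_bot_iff]
  rintro _ ⟨γ, hγ, rfl⟩
  have hF := initial_loopless F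
  rw [eq_zero_of_chainPairing_topeMono hF (γ := γ) fun S => ?_, map_zero]
  · exact Submodule.zero_mem _
  suffices Submodule.span ℤ ((M.initial F).topeMono '' {S' |
      (M.initial F).IsNBC r ∅ Finset.univ S' ∧ S'.card ≤ S.card}) ≤
      LinearMap.ker ((M.initial F).chainPairing γ) from this (topeMono_mem_span_isNBC hF hr S)
  rw [Submodule.span_le]
  rintro _ ⟨S', ⟨hnbc, -⟩, rfl⟩
  exact (mem_dualFiltration_iff_topeMono _ _ _).1 hγ S'
    (Nat.lt_succ_of_le (card_le_rank_of_isNBC_initial F hr hnbc))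

/-! ### Cosheaves of submodules -/

/-- The map of cosheaves of submodules induced by a linear map of the ambient modules. -/
def subCosheafMap {V W : Type u} [AddCommGroup V] [AddCommGroup W]
    {N : M.FlatFlag → Submodule ℤ V} {L : M.FlatFlag → Submodule ℤ W} (hN : Antitone N)
    (hL : Antitone L) (f : V →ₗ[ℤ] W) (hf : ∀ F, ∀ x ∈ N F, f x ∈ L F) :
    subCosheaf hN ⟶ subCosheaf hL where
  app F := ModuleCat.ofHom (f.restrict (hf F.unop))

theorem mono_subCosheafIncl {V : Type u} [AddCommGroup V] {N N' : M.FlatFlag → Submodule ℤ V}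
    (hN : Antitone N) (hN' : Antitone N') (h : ∀ F, N F ≤ N' F) :
    Mono (subCosheafIncl hN hN' h) := by
  have : ∀ F, Mono ((subCosheafIncl hN hN' h).app F) := fun F =>
    (ModuleCat.mono_iff_injective _).2 (Submodule.inclusion_injective (h F.unop))
  exact NatTrans.mono_of_mono_app _

/-- A pointwise criterion for a short exact sequence of cosheaves of submodules. -/
theorem shortExact_subCosheaf {V W : Type u} [AddCommGroup V] [AddCommGroup W]
    {N N' : M.FlatFlag → Submodule ℤ V} {L : M.FlatFlag → Submodule ℤ W} (hN : Antitone N)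
    (hN' : Antitone N') (hL : Antitone L) (h : ∀ F, N F ≤ N' F) (f : V →ₗ[ℤ] W)
    (hf : ∀ F, ∀ x ∈ N' F, f x ∈ L F) (hker : ∀ F, ∀ x ∈ N' F, f x = 0 ↔ x ∈ N F)
    (hsurj : ∀ F, ∀ y ∈ L F, ∃ x ∈ N' F, f x = y) :
    ∃ w : subCosheafIncl hN hN' h ≫ subCosheafMap hN' hL f hf = 0,
      (ShortComplex.mk (subCosheafIncl hN hN' h) (subCosheafMap hN' hL f hf) w).ShortExact := by
  have w : subCosheafIncl hN hN' h ≫ subCosheafMap hN' hL f hf = 0 := by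
    ext F x
    exact Subtype.ext ((hker F.unop _ (h F.unop x.2)).2 x.2)
  have hm := mono_subCosheafIncl hN hN' h
  have he : Epi (subCosheafMap hN' hL f hf) := by
    have : ∀ F, Epi ((subCosheafMap hN' hL f hf).app F) := fun F =>
      (ModuleCat.epi_iff_surjective _).2 fun y => by
        obtain ⟨x, hx, hxy⟩ := hsurj F.unop y.1 y.2
        exact ⟨⟨x, hx⟩, Subtype.ext hxy⟩
    exact NatTrans.epi_of_epi_app _
  refine ⟨w, { exact := ?_, mono_f := hm, epi_g := he }⟩
  have hmem : ∀ {G : M.Cosheaf} (k : G ⟶ subCosheaf hN'),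
      k ≫ subCosheafMap hN' hL f hf = 0 → ∀ F (x : G.obj F), ((k.app F).hom x).1 ∈ N F.unop := by
    intro G k hk F x
    have hx : ((k ≫ subCosheafMap hN' hL f hf).app F).hom x = 0 := by
      rw [hk]
      rfl
    exact (hker F.unop _ ((k.app F).hom x).2).1 (congrArg Subtype.val hx)
  refine ShortComplex.exact_of_f_is_kernel _ (Limits.KernelFork.IsLimit.ofι _ _
    (fun {G} k hk => { app := fun F => ModuleCat.ofHom
                        (((N' F.unop).subtype ∘ₗ (k.app F).hom).codRestrict (N F.unop) (hmem k hk F))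
                       naturality := fun F F' g => ?_ }) (fun k hk => ?_) fun k hk m hm' => ?_)
  · ext x
    exact Subtype.ext (congrArg
      (fun φ : G.obj F ⟶ (subCosheaf hN').obj F' => (φ.hom x).1) (k.naturality g))
  · ext F x
    rfl
  · rw [← cancel_mono (subCosheafIncl hN hN' h), hm']
    ext F x
    rfl

end OrientedMatroid

theorem theoremC {E : Type u} [Fintype E] (M : OrientedMatroid E) (hM : M.Loopless) :
    -- the tope spaces, the dual Varchenko–Gelfand modules and the dual Cordovil modules of the
    -- initial oriented matroids are cosheaves with respect to inclusions
    ∃ (hS : Antitone M.signStalk) (hP : ∀ p, Antitone (M.vgStalk p))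
      (hA : ∀ p, Antitone (M.cordovilStalk p))
      (hle : ∀ p F, M.vgStalk (p + 1) F ≤ M.vgStalk p F)
      (hle₁ : ∀ F, M.vgStalk 1 F ≤ M.signStalk F),
      -- the filtration of the sign cosheaf
      Mono (OrientedMatroid.subCosheafIncl (hP 1) hS hle₁) ∧
      (∀ p, Mono (OrientedMatroid.subCosheafIncl (hP (p + 1)) (hP p) (hle p))) ∧
      M.vgStalk 0 = M.signStalk ∧
      (∀ F, M.vgStalk (M.rank + 1) F = ⊥) ∧
      -- the short exact sequences
      ∀ p, ∃ (a : OrientedMatroid.subCosheaf (hP p) ⟶ OrientedMatroid.subCosheaf (hA p))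
        (w : OrientedMatroid.subCosheafIncl (hP (p + 1)) (hP p) (hle p) ≫ a = 0),
        (ShortComplex.mk (OrientedMatroid.subCosheafIncl (hP (p + 1)) (hP p) (hle p)) a
          w).ShortExact := by

  refine ⟨M.signStalk_antitone, M.vgStalk_antitone, M.cordovilStalk_antitone, M.vgStalk_succ_le,
    fun F => M.vgStalk_zero ▸ M.vgStalk_succ_le 0 F, OrientedMatroid.mono_subCosheafIncl _ _ _,
    fun p => OrientedMatroid.mono_subCosheafIncl _ _ _, M.vgStalk_zero, M.vgStalk_rank_succ,
    fun p => ⟨_, OrientedMatroid.shortExact_subCosheaf _ _ (M.cordovilStalk_antitone p) _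
      (OrientedMatroid.leadingPart E p)
      (fun F x hx => OrientedMatroid.leadingPart_mem_cordovilStalk hx)
      (fun F x hx => OrientedMatroid.leadingPart_eq_zero_iff_mem_vgStalk hx)
      (fun F y hy => OrientedMatroid.exists_leadingPart_eq_of_mem_cordovilStalk hy)⟩⟩
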